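/- **Supra-competitive limiting prices.** Let $N\ge 2$, $a>0$, $b>c>0$, and let $P_{\min},P_{\max}$ satisfy $0<P_{\min}\le p^{NE}<P_{\max}\le a/b$, where $p^{NE}:=\frac{a}{2b-c}$ is the Nash price. For $x\in\mathbb{R}^N$ write $\bar x_{-i}:=\frac1{N-1}\sum_{j\ne i}x_j$, and let $\mathrm{BR}(y):=\frac{a+cy}{2b}$. Let $\mu\in[P_{\min},P_{\max}]^N$ and $\Sigma_{\exp}=\mathrm{diag}(\sigma_1^2,\dots,\sigma_N^2)$ with every $\sigma_i>0$. For $(U,V)\in\mathbb{R}^N\times\mathbb{R}^{N\times N}$ put $\bar V_{i,-i}:=\frac1{N-1}\sum_{j\ne i}V_{ij}$ and define the posted prices $P(U,V)\in[P_{\min},P_{\max}]^N$ by $$\widetilde P_i:=\frac{(a+c\,\bar U_{-i})V_{ii}-c\,U_i\bar V_{i,-i}}{2(bV_{ii}-c\bar V_{i,-i})},\qquad P_i:=\begin{cases}\max\{P_{\min},\min\{\widetilde P_i,P_{\max}\}\}&\text{if }-bV_{ii}+c\bar V_{i,-i}<0,\\ P_{\max}&\text{otherwise.}\end{cases}$$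 The price-moments ODE is the system, for $\tau\ge1$, $$\dot U=\frac{P-U}{\tau},\qquad \dot V=(P-U)(P-U)^\top,\qquad U(1)=\mu,\quad V(1)=\Sigma_{\exp},$$ with $P=P(U(\tau),V(\tau))$ (and a one-sided derivative at $\tau=1$). It has a unique solution on $[1,\infty)$; let $P^{\mathrm{ODE}}(\tau):=P(U(\tau),V(\tau))$ be its posted price vector. Then: (a) if $\mu_i>\mathrm{BR}(\bar\mu_{-i})$ for every $i$ (that is, $\mu\in\mathcal C^+$), then $P^{\mathrm{ODE}}_i(\tau)>p^{NE}$ for every $i$ and every $\tau\in[1,\infty)$; (b) if $\mu_i<\mathrm{BR}(\bar\mu_{-i})$ for every $i$ (that is, $\mu\in\mathcal C^-$), then there is $\tau_0\in[1,\infty)$ such that $P^{\mathrm{ODE}}_i(\tau)>p^{NE}$ for every $i$ and every $\tau>\tau_0$. -/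

import Mathlib

noncomputable section

namespace PriceMoments

/-- Demand parameters and price bounds: firm `i`'s mean demand at prices `p` is
`a - b * p i + c * (average of the other prices)`, and prices lie in `[Pmin, Pmax]`. -/
structure Market where
  a : ℝ
  b : ℝ
  c : ℝ
  Pmin : ℝ
  Pmax : ℝ

/-- The standing assumptions on the demand parameters and the price bounds. -/
structure Market.Admissible (M : Market) : Prop where
  a_pos : 0 < M.a
  c_pos : 0 < M.c
  c_lt_b : M.c < M.b
  Pmin_pos : 0 < M.Pmin
  Pmin_le_nash : M.Pmin ≤ M.a / (2 * M.b - M.c)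
  nash_lt_Pmax : M.a / (2 * M.b - M.c) < M.Pmax
  Pmax_le : M.Pmax ≤ M.a / M.b

/-- The average `(N - 1)⁻¹ ∑_{j ≠ i} x j` over the competitors of `i`. -/
def othersAvg {N : ℕ} (x : Fin N → ℝ) (i : Fin N) : ℝ :=
  (∑ j ∈ Finset.univ.erase i, x j) / ((N : ℝ) - 1)

/-- The best response to the competitors' average price. -/
def Market.BR (M : Market) (pbar : ℝ) : ℝ := (M.a + M.c * pbar) / (2 * M.b)

/-- The symmetric Nash price. -/
def Market.nash (M : Market) : ℝ := M.a / (2 * M.b - M.c)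

/-- `BR` is the unique maximizer of the profit `p * (a - b p + c pbar)`. -/
theorem Market.Admissible.profit_lt {M : Market} (hM : M.Admissible) {pbar p : ℝ}
    (hp : p ≠ M.BR pbar) :
    p * (M.a - M.b * p + M.c * pbar)
      < M.BR pbar * (M.a - M.b * M.BR pbar + M.c * pbar) := by
  have hb : 0 < M.b := hM.c_pos.trans hM.c_lt_b
  have h : M.a + M.c * pbar = 2 * M.b * M.BR pbar := by
    unfold Market.BR; field_simp
  have h2 : 0 < M.b * (p - M.BR pbar) ^ 2 :=
    mul_pos hb (by have := sub_ne_zero.mpr hp; positivity)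
  have e : ∀ q : ℝ, M.a - M.b * q + M.c * pbar = 2 * M.b * M.BR pbar - M.b * q := by
    intro q; rw [← h]; ring
  rw [e, e]
  nlinarith

/-- The Nash price is the unique fixed point of the best response. -/
theorem Market.Admissible.BR_eq_self_iff {M : Market} (hM : M.Admissible) (p : ℝ) :
    M.BR p = p ↔ p = M.nash := by
  have hb : 0 < M.b := hM.c_pos.trans hM.c_lt_b
  have h1 : 0 < 2 * M.b - M.c := by linarith [hM.c_lt_b]
  unfold Market.BR Market.nash
  rw [div_eq_iff (by positivity), eq_div_iff h1.ne']
  constructor <;> intro h <;> linarith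

/-- The price box `[Pmin, Pmax]^N`. -/
def Market.priceBox (M : Market) (N : ℕ) : Set (Fin N → ℝ) :=
  {p | ∀ i, p i ∈ Set.Icc M.Pmin M.Pmax}

/-- The upper best-response cone `C⁺`. -/
def Market.upperCone (M : Market) (N : ℕ) : Set (Fin N → ℝ) :=
  {μ | μ ∈ M.priceBox N ∧ ∀ i, M.BR (othersAvg μ i) < μ i}

/-- The lower best-response cone `C⁻`. -/
def Market.lowerCone (M : Market) (N : ℕ) : Set (Fin N → ℝ) :=
  {μ | μ ∈ M.priceBox N ∧ ∀ i, μ i < M.BR (othersAvg μ i)}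

/-- The unconstrained price computed by firm `i` from the moments `(U, V)`. -/
def Market.rawPrice (M : Market) {N : ℕ} (U : Fin N → ℝ) (V : Matrix (Fin N) (Fin N) ℝ)
    (i : Fin N) : ℝ :=
  ((M.a + M.c * othersAvg U i) * V i i - M.c * U i * othersAvg (V i) i) /
    (2 * (M.b * V i i - M.c * othersAvg (V i) i))

/-- The posted price of firm `i` at the moments `(U, V)`: the raw price clipped to
`[Pmin, Pmax]` if the fitted slope is negative, and `Pmax` otherwise. -/
def Market.price (M : Market) {N : ℕ} (U : Fin N → ℝ) (V : Matrix (Fin N) (Fin N) ℝ)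
    (i : Fin N) : ℝ :=
  if -M.b * V i i + M.c * othersAvg (V i) i < 0 then
    max M.Pmin (min (M.rawPrice U V i) M.Pmax)
  else M.Pmax

/-- `(U, V)` solves the price-moments ODE on `[1, ∞)` with `U 1 = μ`, `V 1 = S`
(the derivative at `τ = 1` is one-sided; values at `τ < 1` are irrelevant). -/
structure Market.IsSolution (M : Market) {N : ℕ} (μ : Fin N → ℝ)
    (S : Matrix (Fin N) (Fin N) ℝ) (U : ℝ → Fin N → ℝ)
    (V : ℝ → Matrix (Fin N) (Fin N) ℝ) : Prop where
  init_U : U 1 = μ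
  init_V : V 1 = S
  deriv_U : ∀ τ : ℝ, 1 ≤ τ → ∀ i, HasDerivWithinAt (fun t => U t i)
    ((M.price (U τ) (V τ) i - U τ i) / τ) (Set.Ici 1) τ
  deriv_V : ∀ τ : ℝ, 1 ≤ τ → ∀ i j, HasDerivWithinAt (fun t => V t i j)
    ((M.price (U τ) (V τ) i - U τ i) * (M.price (U τ) (V τ) j - U τ j)) (Set.Ici 1) τ

end PriceMoments

end

/-! Write `D i = P i - U i` (`adj`) and let `d i` be the fitted slope `b V i i - c V̄ i`. When `d i
> 0`, the raw price is `U i + pull i / (2 d i)`.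

Well-posedness. The raw price is singular at `d i = 0`, but `b Pmax ≤ a` gives `a + c Ū - b U ≥ c
Pmin > 0`, so the raw price is already above `Pmax` once `d i` is small. The posted price therefore
agrees with a locally Lipschitz function (`price_eq_regPrice`). In the coordinates `(τ, τ U, V)` the
field becomes bounded and locally Lipschitz.

Signs. Initially `pull i` is a positive multiple of `BR - μ i`. The derivative of the pull is a term
with the sign of the competitors' adjustments plus a bounded multiple of `D i`, and `|D i|` is at
most a constant times `|pull i|`. By Grönwall, a common sign of all pulls persists
(`pull_sign_invariant`). All `D i` then share a sign, so the covariances, with derivative `D i * D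
j`, are nonnegative.

Upper cone. Negative pulls and nonnegative covariances force `BR < U`, hence all `U j` exceed the
Nash price, and a direct comparison gives the same for the posted prices.

Lower cone. Every `U i` increases and `P i > U i`, so it suffices that all `U i` exceed the Nash
price at one time. Otherwise all `U i` increase to the Nash price (`tendsto_nash`). In that case the
regression coefficients `V̄ i / V i i` stay above some `m > 0` (`exists_le_othersAvg_V`), which
keeps `D i` bounded below. Since `U' = D / τ`, `U` would grow like `log τ`, a contradiction. The
bound on the coefficients comes from the moving barrier `m exp (K τ E²)`, where `E` is the total
deviation from the Nash price: `τ E²` decreases at rate at least a multiple of `E²`, which pays for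
the times when `D i` is only `O(E)`. -/

open Set Filter Topology Metric

open scoped NNReal

/-! ### Global forward integral curves of bounded locally Lipschitz fields. -/

section GlobalODE

variable {E : Type*} [NormedAddCommGroup E]

theorem LocallyLipschitz.exists_lipschitzOnWith_closedBall [ProperSpace E] {F : E → E}
    (hF : LocallyLipschitz F) (x₀ : E) (R : ℝ) :
    ∃ K : ℝ≥0, LipschitzOnWith K F (closedBall x₀ R) := by
  obtain ⟨K, hK⟩ := hF.locallyLipschitzOn.exists_lipschitzOnWith_of_compact
    (isCompact_closedBall x₀ R)
  exact ⟨K, hK⟩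

variable [NormedSpace ℝ E]

/-- Two forward integral curves of a locally Lipschitz field that start at the same point agree. -/
theorem integralCurve_unique_right [ProperSpace E] {F : E → E} (hF : LocallyLipschitz F)
    {x y : ℝ → E} {t₀ T : ℝ}
    (hx : ∀ t ∈ Icc t₀ T, HasDerivWithinAt x (F (x t)) (Icc t₀ T) t)
    (hy : ∀ t ∈ Icc t₀ T, HasDerivWithinAt y (F (y t)) (Icc t₀ T) t)
    (h0 : x t₀ = y t₀) : ∀ t ∈ Icc t₀ T, x t = y t := by
  have cx : ContinuousOn x (Icc t₀ T) := fun t ht => (hx t ht).continuousWithinAt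
  have cy : ContinuousOn y (Icc t₀ T) := fun t ht => (hy t ht).continuousWithinAt
  obtain ⟨R, hR⟩ := ((isCompact_Icc.image_of_continuousOn cx).union
    (isCompact_Icc.image_of_continuousOn cy)).isBounded.subset_closedBall 0
  obtain ⟨K, hK⟩ := hF.exists_lipschitzOnWith_closedBall 0 R
  have key := ODE_solution_unique_of_mem_Icc_right (v := fun _ => F)
    (s := fun _ => closedBall 0 R) (K := K) (f := x) (g := y) (a := t₀) (b := T)
    (fun _ _ => hK) cx
    (fun t ht => (hx t (Ico_subset_Icc_self ht)).mono_of_mem_nhdsWithin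
      (Icc_mem_nhdsGE_of_mem ht))
    (fun t ht => hR (Or.inl (mem_image_of_mem x (Ico_subset_Icc_self ht)))) cy
    (fun t ht => (hy t (Ico_subset_Icc_self ht)).mono_of_mem_nhdsWithin
      (Icc_mem_nhdsGE_of_mem ht))
    (fun t ht => hR (Or.inr (mem_image_of_mem y (Ico_subset_Icc_self ht)))) h0
  exact key

/-- A bounded locally Lipschitz field has forward integral curves on compact intervals of any
length. -/
theorem exists_integralCurve_Icc [ProperSpace E] {F : E → E} (hF : LocallyLipschitz F)
    {L : ℝ≥0} (hL : ∀ x, ‖F x‖ ≤ L) (x₀ : E) (t₀ T : ℝ) (hT : t₀ ≤ T) :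
    ∃ x : ℝ → E, x t₀ = x₀ ∧ ∀ t ∈ Icc t₀ T, HasDerivWithinAt x (F (x t)) (Icc t₀ T) t := by
  have hT' : 0 ≤ T - t₀ := sub_nonneg.mpr hT
  -- A curve of speed at most `L` travels at most `L * (T - t₀)`, so a Lipschitz constant on this
  -- ball suffices for any `T`.
  obtain ⟨K, hK⟩ := hF.exists_lipschitzOnWith_closedBall x₀
    (L * ⟨T - t₀, hT'⟩ : ℝ≥0)
  have hPL : IsPicardLindelof (fun _ => F) (tmin := t₀) (tmax := T) ⟨t₀, left_mem_Icc.mpr hT⟩ x₀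
      (L * ⟨T - t₀, hT'⟩) 0 L K := by
    refine IsPicardLindelof.of_time_independent (fun x _ => hL x) hK ?_
    have h : ((L * ⟨T - t₀, hT'⟩ : ℝ≥0) : ℝ) = L * (T - t₀) := NNReal.coe_mul _ _
    simp [hT, h]
  obtain ⟨x, hx0, hx⟩ := hPL.exists_eq_forall_mem_Icc_hasDerivWithinAt₀
  exact ⟨x, hx0, hx⟩

/-- A bounded locally Lipschitz field has global forward integral curves. -/
theorem exists_integralCurve_Ici [ProperSpace E] {F : E → E} (hF : LocallyLipschitz F)
    {L : ℝ≥0} (hL : ∀ x, ‖F x‖ ≤ L) (x₀ : E) (t₀ : ℝ) :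
    ∃ x : ℝ → E, x t₀ = x₀ ∧ ∀ t, t₀ ≤ t → HasDerivWithinAt x (F (x t)) (Ici t₀) t := by
  have hn : ∀ n : ℕ, t₀ ≤ t₀ + n := fun n => by simp
  choose x hx0 hx using fun n : ℕ => exists_integralCurve_Icc hF hL x₀ t₀ (t₀ + n) (hn n)
  have agree : ∀ m n : ℕ, m ≤ n → ∀ t ∈ Icc t₀ (t₀ + m), x m t = x n t := by
    intro m n hmn
    have hsub : Icc t₀ (t₀ + m) ⊆ Icc t₀ (t₀ + (n : ℝ)) :=
      Icc_subset_Icc_right (by gcongr)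
    exact integralCurve_unique_right hF (hx m)
      (fun t ht => (hx n t (hsub ht)).mono hsub) ((hx0 m).trans (hx0 n).symm)
  -- Any interval reaching `t` would do, since the curves agree on overlaps.
  let y : ℝ → E := fun t => x ⌈t - t₀⌉₊ t
  have hy : ∀ n : ℕ, ∀ t ∈ Icc t₀ (t₀ + n), y t = x n t := by
    intro n t ht
    have h1 : t - t₀ ≤ ⌈t - t₀⌉₊ := Nat.le_ceil _
    refine agree _ n (Nat.ceil_le.mpr (by linarith [ht.2])) t ⟨ht.1, by linarith⟩
  refine ⟨y, ?_, fun t ht => ?_⟩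
  · rw [hy 0 t₀ (by simp), hx0]
  · obtain ⟨n, hn⟩ := exists_nat_gt (t - t₀)
    have htn : t ∈ Icc t₀ (t₀ + n) := ⟨ht, by linarith⟩
    have h1 := (hx n t htn).congr_of_mem (fun s hs => hy n s hs) htn
    rw [← hy n t htn] at h1
    refine h1.mono_of_mem_nhdsWithin ?_
    rw [← Ici_inter_Iic]
    exact inter_mem self_mem_nhdsWithin (mem_nhdsWithin_of_mem_nhds (Iic_mem_nhds (by linarith)))

end GlobalODE

/-! ### Closure properties of locally Lipschitz functions. -/

section LocallyLipschitzReal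

variable {X : Type*} [PseudoEMetricSpace X]

theorem LocallyLipschitz.mul_real {f g : X → ℝ} (hf : LocallyLipschitz f)
    (hg : LocallyLipschitz g) : LocallyLipschitz fun x => f x * g x :=
  (ContDiff.locallyLipschitz (𝕂 := ℝ) (f := fun p : ℝ × ℝ => p.1 * p.2) (by fun_prop)).comp
    (hf.prodMk hg)

theorem lipschitzWith_inv_max {ε : ℝ} (hε : 0 < ε) :
    LipschitzWith ⟨ε⁻¹ ^ 2, by positivity⟩ fun y : ℝ => (max y ε)⁻¹ := by
  refine LipschitzWith.of_dist_le_mul fun x y => ?_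
  have hx : ε ≤ max x ε := le_max_right _ _
  have hy : ε ≤ max y ε := le_max_right _ _
  have hx0 := hε.trans_le hx
  have hy0 := hε.trans_le hy
  rw [Real.dist_eq, Real.dist_eq, inv_sub_inv hx0.ne' hy0.ne', abs_div, abs_of_pos (mul_pos hx0 hy0),
    div_eq_inv_mul]
  have h1 : |max y ε - max x ε| ≤ |x - y| := by
    rw [abs_sub_comm x y]; exact abs_max_sub_max_le_abs _ _ _
  have h2 : (max x ε * max y ε)⁻¹ ≤ ε⁻¹ ^ 2 := by
    rw [mul_inv, sq]
    gcongr
  exact mul_le_mul h2 h1 (abs_nonneg _) (sq_nonneg ε⁻¹)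

theorem LocallyLipschitz.inv_max {f : X → ℝ} (hf : LocallyLipschitz f) {ε : ℝ} (hε : 0 < ε) :
    LocallyLipschitz fun x => (max (f x) ε)⁻¹ :=
  (lipschitzWith_inv_max hε).locallyLipschitz.comp hf

theorem LocallyLipschitz.finset_sum {ι : Type*} (s : Finset ι) {f : ι → X → ℝ}
    (hf : ∀ i, LocallyLipschitz (f i)) : LocallyLipschitz fun x => ∑ i ∈ s, f i x := by
  classical
  induction s using Finset.induction_on with
  | empty => simpa using LocallyLipschitz.const (0 : ℝ)
  | insert i s hi ih => simpa [Finset.sum_insert hi] using (hf i).add ih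

theorem LocallyLipschitz.pi {ι : Type*} [Fintype ι] {β : ι → Type*}
    [∀ i, PseudoEMetricSpace (β i)] {f : X → ∀ i, β i}
    (hf : ∀ i, LocallyLipschitz fun x => f x i) : LocallyLipschitz f := by
  intro x
  choose K t ht hK using fun i => hf i x
  refine ⟨∑ i, K i, ⋂ i, t i, (iInter_mem).mpr ht, fun y hy z hz => ?_⟩
  refine (edist_pi_le_iff).mpr fun i => (hK i (mem_iInter.mp hy i) (mem_iInter.mp hz i)).trans ?_
  gcongr
  exact_mod_cast Finset.single_le_sum (f := K) (fun _ _ => zero_le) (Finset.mem_univ i)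

end LocallyLipschitzReal

theorem monotoneOn_Ici_of_hasDerivWithinAt_nonneg {f f' : ℝ → ℝ} {s : ℝ}
    (hf : ∀ t, s ≤ t → HasDerivWithinAt f (f' t) (Ici s) t) (h0 : ∀ t, s ≤ t → 0 ≤ f' t) :
    MonotoneOn f (Ici s) := by
  refine monotoneOn_of_hasDerivWithinAt_nonneg (f' := f') (convex_Ici s)
    (fun t ht => (hf t ht).continuousWithinAt) (fun t ht => ?_) (fun t ht => ?_)
  · exact (hf t (interior_subset ht)).mono interior_subset
  · exact h0 t (interior_subset ht)

/-! ### Competitor averages, market constants and the regularized price. -/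

namespace PriceMoments

section OthersAvg

variable {N : ℕ}

theorem othersAvg_mono (hN : 2 ≤ N) {x y : Fin N → ℝ} {i : Fin N} (h : ∀ j, j ≠ i → x j ≤ y j) :
    othersAvg x i ≤ othersAvg y i := by
  have h1 : (2 : ℝ) ≤ N := by exact_mod_cast hN
  unfold othersAvg
  exact div_le_div_of_nonneg_right
    (Finset.sum_le_sum fun j hj => h j (Finset.ne_of_mem_erase hj)) (by linarith)

theorem othersAvg_const (hN : 2 ≤ N) (r : ℝ) (i : Fin N) : othersAvg (fun _ => r) i = r := by
  have h1 : (2 : ℝ) ≤ N := by exact_mod_cast hN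
  unfold othersAvg
  rw [Finset.sum_const, Finset.card_erase_of_mem (Finset.mem_univ i), Finset.card_univ,
    Fintype.card_fin, nsmul_eq_mul, Nat.cast_sub (by omega), Nat.cast_one]
  field_simp [show (N : ℝ) - 1 ≠ 0 by linarith]

theorem le_othersAvg (hN : 2 ≤ N) {x : Fin N → ℝ} {i : Fin N} {r : ℝ}
    (h : ∀ j, j ≠ i → r ≤ x j) : r ≤ othersAvg x i :=
  (othersAvg_const hN r i).symm.le.trans (othersAvg_mono hN h)

theorem othersAvg_le (hN : 2 ≤ N) {x : Fin N → ℝ} {i : Fin N} {r : ℝ}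
    (h : ∀ j, j ≠ i → x j ≤ r) : othersAvg x i ≤ r :=
  (othersAvg_mono hN h).trans (othersAvg_const hN r i).le

theorem exists_ne_fin (hN : 2 ≤ N) (i : Fin N) : ∃ j, j ≠ i :=
  haveI : Nontrivial (Fin N) := Fin.nontrivial_iff_two_le.mpr hN
  exists_ne i

theorem lt_othersAvg (hN : 2 ≤ N) {x : Fin N → ℝ} {i : Fin N} {r : ℝ}
    (h : ∀ j, j ≠ i → r < x j) : r < othersAvg x i := by
  have h1 : (2 : ℝ) ≤ N := by exact_mod_cast hN
  rw [← othersAvg_const hN r i]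
  obtain ⟨j, hj⟩ := exists_ne_fin hN i
  unfold othersAvg
  refine div_lt_div_of_pos_right (Finset.sum_lt_sum_of_nonempty
    ⟨j, Finset.mem_erase.mpr ⟨hj, Finset.mem_univ j⟩⟩
    fun j hj => h j (Finset.ne_of_mem_erase hj)) (by linarith)

theorem othersAvg_sub (x y : Fin N → ℝ) (i : Fin N) :
    othersAvg (fun j => x j - y j) i = othersAvg x i - othersAvg y i := by
  simp [othersAvg, Finset.sum_sub_distrib, sub_div]

theorem othersAvg_const_mul (r : ℝ) (x : Fin N → ℝ) (i : Fin N) :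
    othersAvg (fun j => r * x j) i = r * othersAvg x i := by
  simp [othersAvg, ← Finset.mul_sum, mul_div_assoc]

theorem othersAvg_div (r : ℝ) (x : Fin N → ℝ) (i : Fin N) :
    othersAvg (fun j => x j / r) i = othersAvg x i / r := by
  simp [othersAvg, ← Finset.sum_div, div_right_comm]

theorem hasDerivWithinAt_othersAvg {x : ℝ → Fin N → ℝ} {x' : Fin N → ℝ} {s : Set ℝ} {t : ℝ}
    (h : ∀ j, HasDerivWithinAt (fun t => x t j) (x' j) s t) (i : Fin N) :
    HasDerivWithinAt (fun t => othersAvg (x t) i) (othersAvg x' i) s t :=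
  (HasDerivWithinAt.fun_sum fun j _ => h j).div_const _

theorem LocallyLipschitz.othersAvg {X : Type*} [PseudoEMetricSpace X] {x : X → Fin N → ℝ}
    (hx : ∀ j, LocallyLipschitz fun t => x t j) (i : Fin N) :
    LocallyLipschitz fun t => othersAvg (x t) i := by
  unfold PriceMoments.othersAvg
  simp only [div_eq_mul_inv]
  exact (LocallyLipschitz.finset_sum _ hx).mul_real (LocallyLipschitz.const _)

end OthersAvg

section Admissible

variable {M : Market}

theorem Market.Admissible.b_pos (hM : M.Admissible) : 0 < M.b := hM.c_pos.trans hM.c_lt_b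

theorem Market.Admissible.nash_mul (hM : M.Admissible) : (2 * M.b - M.c) * M.nash = M.a := by
  have h : 0 < 2 * M.b - M.c := by linarith [hM.c_lt_b, hM.c_pos]
  unfold Market.nash
  field_simp

theorem Market.Admissible.b_mul_Pmax_le (hM : M.Admissible) : M.b * M.Pmax ≤ M.a := by
  have h := hM.Pmax_le
  rw [le_div_iff₀ hM.b_pos] at h
  linarith

theorem Market.Admissible.Pmin_lt_Pmax (hM : M.Admissible) : M.Pmin < M.Pmax :=
  hM.Pmin_le_nash.trans_lt hM.nash_lt_Pmax

theorem Market.Admissible.Pmax_pos (hM : M.Admissible) : 0 < M.Pmax := hM.Pmin_pos.trans hM.Pmin_lt_Pmax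

theorem Market.Admissible.nash_pos (hM : M.Admissible) : 0 < M.nash := hM.Pmin_pos.trans_le hM.Pmin_le_nash

/-- Makes `2 * nash - U i` positive; this is the weight of the covariance in `nash_lt_price`. -/
theorem Market.Admissible.Pmax_lt_two_nash (hM : M.Admissible) : M.Pmax < 2 * M.nash := by
  have h1 := hM.nash_mul
  have h2 := hM.b_mul_Pmax_le
  have h3 := mul_pos hM.c_pos hM.nash_pos
  have h4 : M.b * M.Pmax < M.b * (2 * M.nash) := by linarith
  exact lt_of_mul_lt_mul_left h4 hM.b_pos.le

end Admissible

/-- Truncation to the interval `[Pmin, Pmax]`. -/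
noncomputable def Market.clip (M : Market) (x : ℝ) : ℝ := max M.Pmin (min x M.Pmax)

section Clip

variable {M : Market}

theorem Market.Admissible.clip_mem (hM : M.Admissible) (x : ℝ) : M.clip x ∈ Icc M.Pmin M.Pmax :=
  ⟨le_max_left _ _, max_le hM.Pmin_lt_Pmax.le (min_le_right _ _)⟩

theorem Market.clip_of_mem {x : ℝ} (hx : x ∈ Icc M.Pmin M.Pmax) : M.clip x = x := by
  rw [Market.clip, min_eq_left hx.2, max_eq_right hx.1]

theorem Market.Admissible.clip_of_Pmax_le (hM : M.Admissible) {x : ℝ} (hx : M.Pmax ≤ x) : M.clip x = M.Pmax := by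
  rw [Market.clip, min_eq_right hx, max_eq_right hM.Pmin_lt_Pmax.le]

theorem Market.Admissible.price_mem (hM : M.Admissible) {N : ℕ} (U : Fin N → ℝ)
    (V : Matrix (Fin N) (Fin N) ℝ) (i : Fin N) : M.price U V i ∈ Icc M.Pmin M.Pmax := by
  unfold Market.price
  split_ifs
  · exact hM.clip_mem _
  · exact right_mem_Icc.mpr hM.Pmin_lt_Pmax.le

end Clip

theorem Market.locallyLipschitz_clip {X : Type*} [PseudoEMetricSpace X] (M : Market) {f : X → ℝ}
    (hf : LocallyLipschitz f) : LocallyLipschitz fun x => M.clip (f x) :=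
  (hf.min_const _).const_max _

/-- The posted price with the fitted slope bounded away from zero. -/
noncomputable def Market.regPrice (M : Market) {N : ℕ} (σ U : Fin N → ℝ) (V : Fin N → Fin N → ℝ)
    (i : Fin N) : ℝ :=
  M.clip (U i / 2 + (M.a + M.c * othersAvg U i - M.b * U i) * V i i *
    (max (M.b * V i i - M.c * othersAvg (V i) i) (M.c * M.Pmin * σ i ^ 2 / (2 * M.Pmax)))⁻¹ / 2)

section Price

variable {M : Market} {N : ℕ} {U : Fin N → ℝ} {V : Matrix (Fin N) (Fin N) ℝ} {i : Fin N}

/-- At prices in the box, the demand intercept `a + c Ū - b U` is bounded below by `c * Pmin`. -/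
theorem Market.Admissible.c_mul_Pmin_le (hM : M.Admissible) (hN : 2 ≤ N)
    (hU : U ∈ M.priceBox N) (i : Fin N) :
    M.c * M.Pmin ≤ M.a + M.c * othersAvg U i - M.b * U i := by
  have h1 : M.Pmin ≤ othersAvg U i := le_othersAvg hN fun j _ => (hU j).1
  have h2 := mul_le_mul_of_nonneg_left h1 hM.c_pos.le
  have h3 := mul_le_mul_of_nonneg_left (hU i).2 hM.b_pos.le
  linarith [hM.b_mul_Pmax_le]

/-- Isolates the singular part: the coefficient of the inverse slope is bounded below by a positive
constant. -/
theorem Market.rawPrice_eq (hd : 0 < M.b * V i i - M.c * othersAvg (V i) i) :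
    M.rawPrice U V i = U i / 2 + (M.a + M.c * othersAvg U i - M.b * U i) * V i i *
      (M.b * V i i - M.c * othersAvg (V i) i)⁻¹ / 2 := by
  unfold Market.rawPrice
  set d := M.b * V i i - M.c * othersAvg (V i) i with hd'
  have h : (M.a + M.c * othersAvg U i) * V i i - M.c * U i * othersAvg (V i) i =
      U i * d + (M.a + M.c * othersAvg U i - M.b * U i) * V i i := by rw [hd']; ring
  rw [h]
  field_simp

/-- For a slope at most `ε`, nonpositive ones included, both sides are `Pmax`; above `ε` the
regularization is inactive. -/
theorem Market.Admissible.price_eq_regPrice (hM : M.Admissible) (hN : 2 ≤ N)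
    (hU : U ∈ M.priceBox N) {σ : Fin N → ℝ} (hσ : 0 < σ i) (hV : σ i ^ 2 ≤ V i i) :
    M.price U V i = M.regPrice σ U V i := by
  set d := M.b * V i i - M.c * othersAvg (V i) i with hd
  set ε := M.c * M.Pmin * σ i ^ 2 / (2 * M.Pmax) with hε
  have hε0 : 0 < ε := by
    have := hM.c_pos; have := hM.Pmin_pos; have := hM.Pmax_pos; positivity
  set k := (M.a + M.c * othersAvg U i - M.b * U i) * V i i with hk
  have hkε : 2 * M.Pmax * ε ≤ k := by
    have h1 : 2 * M.Pmax * ε = M.c * M.Pmin * σ i ^ 2 := by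
      have := hM.Pmax_pos; rw [hε]; field_simp
    rw [h1]
    exact mul_le_mul (hM.c_mul_Pmin_le hN hU i) hV (sq_nonneg _)
      ((mul_pos hM.c_pos hM.Pmin_pos).le.trans (hM.c_mul_Pmin_le hN hU i))
  have hU0 : 0 < U i := hM.Pmin_pos.trans_le (hU i).1
  -- `ε` is chosen so that `k / ε ≥ 2 * Pmax`.
  have hlarge : ∀ r, 0 < r → r ≤ ε → M.Pmax ≤ U i / 2 + k * r⁻¹ / 2 := by
    intro r hr hrε
    have : 2 * M.Pmax ≤ k * r⁻¹ := by
      rw [← div_eq_mul_inv, le_div_iff₀ hr]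
      exact (mul_le_mul_of_nonneg_left hrε (by linarith [hM.Pmax_pos])).trans hkε
    linarith
  have hreg : M.regPrice σ U V i = M.clip (U i / 2 + k * (max d ε)⁻¹ / 2) := rfl
  have hcond : (-M.b * V i i + M.c * othersAvg (V i) i < 0) ↔ 0 < d := by
    rw [hd]; constructor <;> intro h <;> linarith
  rw [hreg]
  unfold Market.price
  rw [if_congr hcond rfl rfl]
  split_ifs with h
  · rw [Market.rawPrice_eq h]
    rcases le_total ε d with h1 | h1
    · rw [max_eq_left h1]; rfl
    · rw [max_eq_right h1, hM.clip_of_Pmax_le (hlarge ε hε0 le_rfl)]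
      exact hM.clip_of_Pmax_le (hlarge d h h1)
  · rw [max_eq_right ((not_lt.mp h).trans hε0.le), hM.clip_of_Pmax_le (hlarge ε hε0 le_rfl)]

end Price

/-! ### The truncated autonomous vector field. -/

/-- The price-moments system in the autonomous coordinates `(τ, τ * U, V)`. -/
noncomputable def Market.field (M : Market) {N : ℕ} (σ : Fin N → ℝ)
    (x : ℝ × (Fin N → ℝ) × (Fin N → Fin N → ℝ)) : ℝ × (Fin N → ℝ) × (Fin N → Fin N → ℝ) :=
  -- The clip and the maximum with `1` make the field bounded and everywhere defined; both are
  -- inactive along solutions.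
  let u : Fin N → ℝ := fun i => M.clip (x.2.1 i * (max x.1 1)⁻¹)
  let p := M.regPrice σ u x.2.2
  (1, p, fun i j => (p i - u i) * (p j - u j))

section Field

variable {M : Market} {N : ℕ} {σ : Fin N → ℝ}

theorem Market.field_eq {x : ℝ × (Fin N → ℝ) × (Fin N → Fin N → ℝ)} {u : Fin N → ℝ}
    (hu : ∀ i, M.clip (x.2.1 i * (max x.1 1)⁻¹) = u i) :
    M.field σ x = (1, M.regPrice σ u x.2.2, fun i j =>
      (M.regPrice σ u x.2.2 i - u i) * (M.regPrice σ u x.2.2 j - u j)) := by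
  obtain rfl : u = fun i => M.clip (x.2.1 i * (max x.1 1)⁻¹) := (funext hu).symm
  rfl

theorem Market.Admissible.regPrice_mem (hM : M.Admissible) (U : Fin N → ℝ)
    (V : Fin N → Fin N → ℝ) (i : Fin N) : M.regPrice σ U V i ∈ Icc M.Pmin M.Pmax :=
  hM.clip_mem _

theorem Market.Admissible.locallyLipschitz_field (hM : M.Admissible) (hσ : ∀ i, 0 < σ i) :
    LocallyLipschitz (M.field σ) := by
  have hW : ∀ i, LocallyLipschitz
      fun x : ℝ × (Fin N → ℝ) × (Fin N → Fin N → ℝ) => x.2.1 i := fun i =>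
    ContDiff.locallyLipschitz (𝕂 := ℝ) (by fun_prop)
  have hV : ∀ i j, LocallyLipschitz
      fun x : ℝ × (Fin N → ℝ) × (Fin N → Fin N → ℝ) => x.2.2 i j := fun i j =>
    ContDiff.locallyLipschitz (𝕂 := ℝ) (by fun_prop)
  have hs : LocallyLipschitz
      fun x : ℝ × (Fin N → ℝ) × (Fin N → Fin N → ℝ) => (max x.1 1)⁻¹ :=
    LocallyLipschitz.inv_max LipschitzWith.prod_fst.locallyLipschitz one_pos
  have hu : ∀ i, LocallyLipschitz fun x : ℝ × (Fin N → ℝ) × (Fin N → Fin N → ℝ) =>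
      M.clip (x.2.1 i * (max x.1 1)⁻¹) := fun i =>
    M.locallyLipschitz_clip ((hW i).mul_real hs)
  have cmul : ∀ (r : ℝ) {f : ℝ × (Fin N → ℝ) × (Fin N → Fin N → ℝ) → ℝ}, LocallyLipschitz f →
      LocallyLipschitz fun x => r * f x := fun r f hf =>
    (LocallyLipschitz.const r).mul_real hf
  have hp : ∀ i, LocallyLipschitz fun x : ℝ × (Fin N → ℝ) × (Fin N → Fin N → ℝ) =>
      M.regPrice σ (fun i => M.clip (x.2.1 i * (max x.1 1)⁻¹)) x.2.2 i := by
    intro i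
    have hε0 : 0 < M.c * M.Pmin * σ i ^ 2 / (2 * M.Pmax) := by
      have := hM.c_pos; have := hM.Pmin_pos; have := hM.Pmax_pos; have := hσ i; positivity
    refine M.locallyLipschitz_clip ?_
    simp only [div_eq_mul_inv]
    refine ((hu i).mul_real (LocallyLipschitz.const _)).add
      (LocallyLipschitz.mul_real (LocallyLipschitz.mul_real (LocallyLipschitz.mul_real ?_ (hV i i))
        (LocallyLipschitz.inv_max ?_ hε0)) (LocallyLipschitz.const _))
    · exact ((LocallyLipschitz.const _).add (cmul _ (LocallyLipschitz.othersAvg hu i))).sub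
        (cmul _ (hu i))
    · exact (cmul _ (hV i i)).sub (cmul _ (LocallyLipschitz.othersAvg (hV i) i))
  refine (LocallyLipschitz.const (1 : ℝ)).prodMk ((LocallyLipschitz.pi hp).prodMk
    (LocallyLipschitz.pi fun i => LocallyLipschitz.pi fun j => ?_))
  exact ((hp i).sub (hu i)).mul_real ((hp j).sub (hu j))

theorem Market.Admissible.exists_field_norm_le (hM : M.Admissible) :
    ∃ L : ℝ≥0, ∀ x, ‖M.field σ x‖ ≤ L := by
  have hP := hM.Pmax_pos
  have hm := hM.Pmin_pos
  refine ⟨⟨1 + M.Pmax + M.Pmax ^ 2, by positivity⟩, fun x => ?_⟩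
  have hsq : 0 ≤ M.Pmax ^ 2 := sq_nonneg _
  change ‖M.field σ x‖ ≤ 1 + M.Pmax + M.Pmax ^ 2
  have hdiff : ∀ y z, |M.clip y - M.clip z| ≤ M.Pmax := fun y z => by
    have h1 := hM.clip_mem y
    have h2 := hM.clip_mem z
    exact abs_le.mpr ⟨by linarith [h1.1, h2.2], by linarith [h1.2, h2.1]⟩
  refine norm_prod_le_iff.mpr ⟨?_, norm_prod_le_iff.mpr ⟨?_, ?_⟩⟩
  · change ‖(1 : ℝ)‖ ≤ _
    rw [norm_one]; linarith
  · refine (pi_norm_le_iff_of_nonneg (by positivity)).mpr fun i => ?_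
    have h1 := hM.regPrice_mem (σ := σ) (fun i => M.clip (x.2.1 i * (max x.1 1)⁻¹)) x.2.2 i
    exact (abs_of_nonneg (hm.le.trans h1.1)).le.trans (by linarith [h1.2])
  · refine (pi_norm_le_iff_of_nonneg (by positivity)).mpr fun i =>
      (pi_norm_le_iff_of_nonneg (by positivity)).mpr fun j => ?_
    change |(M.clip _ - M.clip _) * (M.clip _ - M.clip _)| ≤ _
    rw [abs_mul]
    refine (mul_le_mul (hdiff _ _) (hdiff _ _) (abs_nonneg _) hP.le).trans ?_
    nlinarith

end Field

/-! ### Existence and uniqueness for the price-moments ODE. -/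

section Solution

variable {M : Market} {N : ℕ} {μ : Fin N → ℝ} {S : Matrix (Fin N) (Fin N) ℝ}
  {U : ℝ → Fin N → ℝ} {V : ℝ → Matrix (Fin N) (Fin N) ℝ}

/-- The accumulated price `τ * U i` has derivative the posted price. -/
theorem Market.IsSolution.hasDerivWithinAt_mul_U (h : M.IsSolution μ S U V) {τ : ℝ} (hτ : 1 ≤ τ)
    (i : Fin N) :
    HasDerivWithinAt (fun t => t * U t i) (M.price (U τ) (V τ) i) (Ici 1) τ := by
  have h0 : τ ≠ 0 := by positivity
  convert! (hasDerivWithinAt_id τ (Ici 1)).mul (h.deriv_U τ hτ i) using 1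
  simp only [id]
  field_simp
  ring

/-- Both `w t - m * t` and `r * t - w t` are nondecreasing. Applied to `w = τ * U i`, this keeps `U`
in the price box. -/
theorem mem_Icc_mul_of_hasDerivWithinAt {w p : ℝ → ℝ} {m r : ℝ}
    (hw : ∀ t, 1 ≤ t → HasDerivWithinAt w (p t) (Ici 1) t)
    (hp : ∀ t, 1 ≤ t → p t ∈ Icc m r) (h1 : w 1 ∈ Icc m r) {τ : ℝ} (hτ : 1 ≤ τ) :
    w τ ∈ Icc (m * τ) (r * τ) := by
  have hid : ∀ t : ℝ, HasDerivWithinAt (fun t : ℝ => t) 1 (Ici 1) t := fun t =>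
    hasDerivWithinAt_id t _
  have hlo := monotoneOn_Ici_of_hasDerivWithinAt_nonneg (f := fun t => w t - m * t)
    (fun t ht => (hw t ht).sub ((hid t).const_mul m))
    (fun t ht => by linarith [(hp t ht).1]) self_mem_Ici hτ hτ
  have hhi := monotoneOn_Ici_of_hasDerivWithinAt_nonneg (f := fun t => r * t - w t)
    (fun t ht => ((hid t).const_mul r).sub (hw t ht))
    (fun t ht => by linarith [(hp t ht).2]) self_mem_Ici hτ hτ
  simp only at hlo hhi
  constructor <;> linarith [h1.1, h1.2]

theorem Market.IsSolution.U_mem (hM : M.Admissible) (hμ : μ ∈ M.priceBox N)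
    (h : M.IsSolution μ S U V) {τ : ℝ} (hτ : 1 ≤ τ) : U τ ∈ M.priceBox N := by
  intro i
  have h0 : 0 < τ := by linarith
  have := mem_Icc_mul_of_hasDerivWithinAt (fun t ht => h.hasDerivWithinAt_mul_U ht i)
    (fun t _ => hM.price_mem (U t) (V t) i) (by simpa [h.init_U] using hμ i) hτ
  constructor
  · exact le_of_mul_le_mul_right (by linarith [this.1]) h0
  · exact le_of_mul_le_mul_right (by linarith [this.2]) h0

theorem Market.IsSolution.le_V_diag (h : M.IsSolution μ S U V) {τ : ℝ} (hτ : 1 ≤ τ) (i : Fin N) :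
    S i i ≤ V τ i i := by
  have := monotoneOn_Ici_of_hasDerivWithinAt_nonneg (fun t ht => h.deriv_V t ht i i)
    (fun t _ => mul_self_nonneg _) self_mem_Ici hτ hτ
  simpa [h.init_V] using this

variable {σ : Fin N → ℝ}

theorem Market.IsSolution.price_eq_regPrice (hM : M.Admissible) (hN : 2 ≤ N)
    (hμ : μ ∈ M.priceBox N) (hσ : ∀ i, 0 < σ i)
    (h : M.IsSolution μ (Matrix.diagonal fun i => σ i ^ 2) U V) {τ : ℝ} (hτ : 1 ≤ τ) :
    M.price (U τ) (V τ) = M.regPrice σ (U τ) (V τ) := by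
  funext i
  exact hM.price_eq_regPrice hN (h.U_mem hM hμ hτ) (hσ i) (by simpa using h.le_V_diag hτ i)

/-- A solution of the price-moments system is an integral curve of `Market.field`. -/
theorem Market.IsSolution.hasDerivWithinAt_field (hM : M.Admissible) (hN : 2 ≤ N)
    (hμ : μ ∈ M.priceBox N) (hσ : ∀ i, 0 < σ i)
    (h : M.IsSolution μ (Matrix.diagonal fun i => σ i ^ 2) U V) {τ : ℝ} (hτ : 1 ≤ τ) :
    HasDerivWithinAt
      (fun t => ((t, fun i => t * U t i, fun i j => V t i j) :
        ℝ × (Fin N → ℝ) × (Fin N → Fin N → ℝ)))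
      (M.field σ (τ, fun i => τ * U τ i, fun i j => V τ i j)) (Ici 1) τ := by
  have h0 : τ ≠ 0 := by positivity
  have hu : ∀ i, M.clip (τ * U τ i * (max τ 1)⁻¹) = U τ i := by
    intro i
    rw [max_eq_left hτ, mul_comm τ, mul_inv_cancel_right₀ h0]
    exact Market.clip_of_mem (h.U_mem hM hμ hτ i)
  have hp := h.price_eq_regPrice hM hN hμ hσ hτ
  have hF : M.field σ (τ, fun i => τ * U τ i, fun i j => V τ i j) =
      (1, M.price (U τ) (V τ), fun i j =>
        (M.price (U τ) (V τ) i - U τ i) * (M.price (U τ) (V τ) j - U τ j)) := by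
    rw [Market.field_eq hu, hp]
  rw [hF]
  refine (hasDerivWithinAt_id τ _).prodMk (HasDerivWithinAt.prodMk ?_ ?_)
  · exact hasDerivWithinAt_pi.mpr fun i => h.hasDerivWithinAt_mul_U hτ i
  · exact hasDerivWithinAt_pi.mpr fun i => hasDerivWithinAt_pi.mpr fun j => h.deriv_V τ hτ i j

theorem Market.IsSolution.unique (hM : M.Admissible) (hN : 2 ≤ N)
    (hμ : μ ∈ M.priceBox N) (hσ : ∀ i, 0 < σ i)
    {U' : ℝ → Fin N → ℝ} {V' : ℝ → Matrix (Fin N) (Fin N) ℝ}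
    (h : M.IsSolution μ (Matrix.diagonal fun i => σ i ^ 2) U V)
    (h' : M.IsSolution μ (Matrix.diagonal fun i => σ i ^ 2) U' V') {τ : ℝ} (hτ : 1 ≤ τ) :
    U' τ = U τ ∧ V' τ = V τ := by
  have h0 : τ ≠ 0 := by positivity
  have key := integralCurve_unique_right (hM.locallyLipschitz_field hσ) (t₀ := 1) (T := τ)
    (fun t ht => (h'.hasDerivWithinAt_field hM hN hμ hσ ht.1).mono Icc_subset_Ici_self)
    (fun t ht => (h.hasDerivWithinAt_field hM hN hμ hσ ht.1).mono Icc_subset_Ici_self)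
    (by simp [h.init_U, h.init_V, h'.init_U, h'.init_V]) τ (right_mem_Icc.mpr hτ)
  simp only [Prod.mk.injEq, true_and] at key
  constructor
  · funext i
    exact mul_left_cancel₀ h0 (congrFun key.1 i)
  · funext i j
    exact congrFun (congrFun key.2 i) j

/-- The truncated field is integrated globally; a priori bounds on that curve then show that no
truncation was active. -/
theorem Market.Admissible.exists_isSolution (hM : M.Admissible) (hN : 2 ≤ N)
    (hμ : μ ∈ M.priceBox N) (hσ : ∀ i, 0 < σ i) :
    ∃ U V, M.IsSolution μ (Matrix.diagonal fun i => σ i ^ 2) U V := by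
  obtain ⟨L, hL⟩ := hM.exists_field_norm_le (σ := σ)
  obtain ⟨x, hx1, hx⟩ := exists_integralCurve_Ici (hM.locallyLipschitz_field hσ) hL
    (1, μ, fun i j => (Matrix.diagonal fun i => σ i ^ 2 : Matrix (Fin N) (Fin N) ℝ) i j) 1
  have hs' : ∀ t, 1 ≤ t → HasDerivWithinAt (fun t => (x t).1) 1 (Ici 1) t := fun t ht =>
    (hasFDerivAt_fst.comp_hasDerivWithinAt t (hx t ht) :)
  have hW' : ∀ t, 1 ≤ t → ∀ i, HasDerivWithinAt (fun t => (x t).2.1 i)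
      ((M.field σ (x t)).2.1 i) (Ici 1) t := fun t ht i =>
    hasDerivWithinAt_pi.mp (hasFDerivAt_fst.comp_hasDerivWithinAt t
      (hasFDerivAt_snd.comp_hasDerivWithinAt t (hx t ht)) :) i
  have hV' : ∀ t, 1 ≤ t → ∀ i j, HasDerivWithinAt (fun t => (x t).2.2 i j)
      ((M.field σ (x t)).2.2 i j) (Ici 1) t := fun t ht i j =>
    hasDerivWithinAt_pi.mp (hasDerivWithinAt_pi.mp (hasFDerivAt_snd.comp_hasDerivWithinAt t
      (hasFDerivAt_snd.comp_hasDerivWithinAt t (hx t ht)) :) i) j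
  have hs : ∀ t, 1 ≤ t → (x t).1 = t := by
    intro t ht
    -- With `m = r = 1` the two bounds coincide and identify the first coordinate with time.
    have := mem_Icc_mul_of_hasDerivWithinAt hs' (m := 1) (r := 1) (by simp) (by simp [hx1]) ht
    simpa using le_antisymm this.2 this.1
  have hW : ∀ t, 1 ≤ t → ∀ i, (x t).2.1 i ∈ Icc (M.Pmin * t) (M.Pmax * t) := fun t ht i =>
    mem_Icc_mul_of_hasDerivWithinAt (fun t ht => hW' t ht i)
      (fun t _ => hM.clip_mem _) (by simpa [hx1] using hμ i) ht
  have hV : ∀ t, 1 ≤ t → ∀ i, σ i ^ 2 ≤ (x t).2.2 i i := by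
    intro t ht i
    have := monotoneOn_Ici_of_hasDerivWithinAt_nonneg (fun t ht => hV' t ht i i)
      (fun t _ => mul_self_nonneg _) self_mem_Ici ht ht
    simpa [hx1] using this
  have hbox : ∀ t, 1 ≤ t → (fun i => (x t).2.1 i / t) ∈ M.priceBox N := by
    intro t ht i
    have h0 : 0 < t := by linarith
    exact ⟨(le_div_iff₀ h0).mpr (hW t ht i).1, (div_le_iff₀ h0).mpr (hW t ht i).2⟩
  have hF : ∀ t, 1 ≤ t → M.field σ (x t) =
      (1, M.price (fun i => (x t).2.1 i / t) (x t).2.2, fun i j =>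
        (M.price (fun i => (x t).2.1 i / t) (x t).2.2 i - (x t).2.1 i / t) *
        (M.price (fun i => (x t).2.1 i / t) (x t).2.2 j - (x t).2.1 j / t)) := by
    intro t ht
    have hu : ∀ i, M.clip ((x t).2.1 i * (max (x t).1 1)⁻¹) = (x t).2.1 i / t := by
      intro i
      rw [hs t ht, max_eq_left ht, ← div_eq_mul_inv]
      exact Market.clip_of_mem (hbox t ht i)
    have hp : M.price (fun i => (x t).2.1 i / t) (x t).2.2 =
        M.regPrice σ (fun i => (x t).2.1 i / t) (x t).2.2 := by
      funext i
      exact hM.price_eq_regPrice hN (hbox t ht) (hσ i) (hV t ht i)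
    rw [Market.field_eq hu, hp]
  refine ⟨fun t i => (x t).2.1 i / t, fun t => (x t).2.2, ⟨?_, ?_, ?_, ?_⟩⟩
  · funext i; simp [hx1]
  · simp only [hx1]; rfl
  · intro t ht i
    have h0 : t ≠ 0 := by positivity
    have h1 := hW' t ht i
    rw [hF t ht] at h1
    convert! h1.div (hasDerivWithinAt_id t _) h0 using 1
    simp only [id]
    field_simp
  · intro t ht i j
    have h1 := hV' t ht i j
    rw [hF t ht] at h1
    exact h1

end Solution

end PriceMoments

/-! ### First-zero and barrier arguments. -/

/-- A finite family of continuous functions that starts positive and never has a first zero stays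
positive. -/
theorem forall_pos_of_no_first_zero {ι : Type*} [Finite ι] {f : ι → ℝ → ℝ} {s : ℝ}
    (hc : ∀ i, ContinuousOn (f i) (Ici s)) (h0 : ∀ i, 0 < f i s)
    (hstep : ∀ T, s < T → (∀ t ∈ Ico s T, ∀ i, 0 < f i t) → (∀ i, 0 ≤ f i T) → ∀ i, 0 < f i T) :
    ∀ t, s ≤ t → ∀ i, 0 < f i t := by
  by_contra! hcon
  obtain ⟨t₁, ht₁, i₁, hi₁⟩ := hcon
  set B : Set ℝ := ⋃ i, {t ∈ Ici s | f i t ∈ Iic 0} with hB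
  have hclosed : IsClosed B :=
    isClosed_iUnion_of_finite fun i => (hc i).preimage_isClosed_of_isClosed isClosed_Ici isClosed_Iic
  have hbdd : BddBelow B := ⟨s, fun t ht => by
    obtain ⟨i, hi⟩ := mem_iUnion.mp ht
    exact hi.1⟩
  have hT : sInf B ∈ B := hclosed.csInf_mem ⟨t₁, mem_iUnion.mpr ⟨i₁, ht₁, hi₁⟩⟩ hbdd
  set T := sInf B
  obtain ⟨i, hsT, hiT⟩ := mem_iUnion.mp hT
  have hsT : s ≤ T := hsT
  have hiT : f i T ≤ 0 := hiT
  have hlt : s < T := lt_of_le_of_ne hsT fun h => by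
    rw [← h] at hiT
    exact (h0 i).not_ge hiT
  have hbefore : ∀ t ∈ Ico s T, ∀ j, 0 < f j t := by
    intro t ht j
    by_contra! hj
    exact (csInf_le hbdd (mem_iUnion.mpr ⟨j, ht.1, hj⟩)).not_gt ht.2
  have hge : ∀ i, 0 ≤ f i T := by
    intro i
    have hcl : T ∈ closure (Ico s T) := by
      rw [closure_Ico hlt.ne]; exact right_mem_Icc.mpr hsT
    have hcont : ContinuousWithinAt (f i) (Ico s T) T := (hc i T hsT).mono Ico_subset_Ici_self
    exact closure_minimal (t := Ici (0 : ℝ)) (by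
      rintro _ ⟨t, ht, rfl⟩
      exact (hbefore t ht i).le) isClosed_Ici (hcont.mem_closure_image hcl)
  exact (hstep T hlt hbefore hge i).not_ge hiT

/-- If `f` is positive before `T` and has positive derivative at `T`, then `f T ≠ 0`. -/
theorem pos_of_pos_before_of_hasDerivWithinAt_pos {f : ℝ → ℝ} {f' s T : ℝ} (hsT : s < T)
    (hpos : ∀ t ∈ Ico s T, 0 < f t) (hd : HasDerivWithinAt f f' (Ici s) T)
    (hT : 0 ≤ f T) (hf' : f T = 0 → 0 < f') : 0 < f T := by
  refine lt_of_le_of_ne hT fun h => ?_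
  have hlim : Tendsto (slope f T) (𝓝[Ico s T] T) (𝓝 f') :=
    (hasDerivWithinAt_iff_tendsto_slope.mp hd).mono_left
      (nhdsWithin_mono _ fun t ht => ⟨ht.1, ht.2.ne⟩)
  have : (𝓝[Ico s T] T).NeBot := by
    rw [← mem_closure_iff_nhdsWithin_neBot, closure_Ico hsT.ne]
    exact right_mem_Icc.mpr hsT.le
  refine (hf' h.symm).not_ge (le_of_tendsto hlim ?_)
  filter_upwards [self_mem_nhdsWithin] with t ht
  rw [slope_def_field, ← h, sub_zero]
  exact div_nonpos_of_nonneg_of_nonpos (hpos t ht).le (by linarith [ht.2])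

/-- Exponential lower barrier: `f' ≥ -C f` on `[s, T)` keeps `f` positive at `T`. -/
theorem pos_of_neg_mul_le_deriv {f f' : ℝ → ℝ} {s T C : ℝ} (hsT : s < T) (h0 : 0 < f s)
    (hf : ∀ t ∈ Icc s T, HasDerivWithinAt f (f' t) (Icc s T) t)
    (hb : ∀ t ∈ Ioo s T, -C * f t ≤ f' t) : 0 < f T := by
  have hd : ∀ t ∈ Icc s T, HasDerivWithinAt (fun t => f t * Real.exp (C * t))
      (f' t * Real.exp (C * t) + f t * (Real.exp (C * t) * C)) (Icc s T) t := fun t ht => by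
    have h1 : HasDerivWithinAt (fun t : ℝ => C * t) C (Icc s T) t := by
      simpa using (hasDerivWithinAt_id t (Icc s T)).const_mul C
    exact (hf t ht).mul h1.exp
  have hmono : MonotoneOn (fun t => f t * Real.exp (C * t)) (Icc s T) := by
    refine monotoneOn_of_hasDerivWithinAt_nonneg (convex_Icc s T)
      (fun t ht => (hd t ht).continuousWithinAt)
      (fun t ht => (hd t (interior_subset ht)).mono interior_subset) fun t ht => ?_
    rw [interior_Icc] at ht
    have := mul_nonneg (sub_nonneg.mpr (hb t ht)) (Real.exp_pos (C * t)).le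
    linarith
  have h1 := hmono (left_mem_Icc.mpr hsT.le) (right_mem_Icc.mpr hsT.le) hsT.le
  have h2 : 0 < f T * Real.exp (C * T) := (mul_pos h0 (Real.exp_pos _)).trans_le h1
  exact pos_of_mul_pos_left h2 (Real.exp_pos _).le

/-! ### The pull and pointwise bounds on the adjustment. -/

namespace PriceMoments

/-- The numerator of the adjustment `rawPrice - U`; its sign decides whether firm `i` posts a price
above or below its running average. -/
noncomputable def Market.pull (M : Market) {N : ℕ} (U : Fin N → ℝ) (V : Matrix (Fin N) (Fin N) ℝ)
    (i : Fin N) : ℝ :=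
  (M.a + M.c * othersAvg U i - 2 * M.b * U i) * V i i + M.c * U i * othersAvg (V i) i

section Pull

variable {M : Market} {N : ℕ} {U : Fin N → ℝ} {V : Matrix (Fin N) (Fin N) ℝ} {i : Fin N}

theorem Market.rawPrice_eq_add_pull (hd : 0 < M.b * V i i - M.c * othersAvg (V i) i) :
    M.rawPrice U V i =
      U i + M.pull U V i / (2 * (M.b * V i i - M.c * othersAvg (V i) i)) := by
  unfold Market.rawPrice Market.pull
  rw [← sub_eq_iff_eq_add', eq_div_iff (by positivity), sub_mul, div_mul_cancel₀ _ (by positivity)]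
  ring

theorem Market.price_of_pos (hd : 0 < M.b * V i i - M.c * othersAvg (V i) i) :
    M.price U V i = M.clip
      (U i + M.pull U V i / (2 * (M.b * V i i - M.c * othersAvg (V i) i))) := by
  rw [← Market.rawPrice_eq_add_pull hd]
  exact if_pos (by linarith)

theorem Market.price_of_nonpos (hd : M.b * V i i - M.c * othersAvg (V i) i ≤ 0) :
    M.price U V i = M.Pmax :=
  if_neg (by linarith)

/-- In the price box with positive variance the first term on the right is bounded below, so the
slope and the pull cannot both be small. -/
theorem Market.mul_slope_eq (U : Fin N → ℝ) (V : Matrix (Fin N) (Fin N) ℝ) (i : Fin N) :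
    U i * (M.b * V i i - M.c * othersAvg (V i) i) =
      (M.a + M.c * othersAvg U i - M.b * U i) * V i i - M.pull U V i := by
  unfold Market.pull; ring

/-- If the pull is at most half its critical value, the fitted slope is bounded away from zero. -/
theorem Market.Admissible.le_slope (hM : M.Admissible) (hN : 2 ≤ N) (hU : U ∈ M.priceBox N)
    {v : ℝ} (hv : 0 < v) (hV : v ≤ V i i) (hG : M.pull U V i ≤ M.c * M.Pmin * v / 2) :
    M.c * M.Pmin * v / (2 * M.Pmax) ≤ M.b * V i i - M.c * othersAvg (V i) i := by
  have hκ := mul_pos hM.c_pos hM.Pmin_pos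
  have h1 := M.mul_slope_eq U V i
  have h2 : M.c * M.Pmin * v ≤ (M.a + M.c * othersAvg U i - M.b * U i) * V i i :=
    mul_le_mul (hM.c_mul_Pmin_le hN hU i) hV hv.le (hκ.le.trans (hM.c_mul_Pmin_le hN hU i))
  have h3 : M.c * M.Pmin * v / 2 ≤ U i * (M.b * V i i - M.c * othersAvg (V i) i) := by
    linarith
  have hU0 : 0 < U i := hM.Pmin_pos.trans_le (hU i).1
  have hd : 0 < M.b * V i i - M.c * othersAvg (V i) i :=
    pos_of_mul_pos_right (lt_of_lt_of_le (by positivity) h3) hU0.le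
  rw [div_le_iff₀ (by linarith [hM.Pmax_pos])]
  have := mul_le_mul_of_nonneg_right (hU i).2 hd.le
  linarith

/-- A nonpositive pull keeps the slope away from zero by `le_slope`. The linear bound on the
adjustment feeds the Grönwall argument in `pull_sign_invariant`. -/
theorem Market.Admissible.price_le_of_pull_nonpos (hM : M.Admissible) (hN : 2 ≤ N)
    (hU : U ∈ M.priceBox N) {v : ℝ} (hv : 0 < v) (hV : v ≤ V i i) (hG : M.pull U V i ≤ 0) :
    M.price U V i ≤ U i ∧
      (U i - M.price U V i) * (M.c * M.Pmin * v / (2 * M.Pmax)) ≤ -M.pull U V i := by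
  have hκ := mul_pos hM.c_pos hM.Pmin_pos
  have hP := hM.Pmax_pos
  have hκv : 0 < M.c * M.Pmin * v / (2 * M.Pmax) := by positivity
  have hle := hM.le_slope hN hU hv hV (hG.trans (by positivity))
  have hd := hκv.trans_le hle
  rw [Market.price_of_pos hd]
  set d := M.b * V i i - M.c * othersAvg (V i) i
  have hq : M.pull U V i / (2 * d) ≤ 0 := div_nonpos_of_nonpos_of_nonneg hG (by positivity)
  have hmin : min (U i + M.pull U V i / (2 * d)) M.Pmax = U i + M.pull U V i / (2 * d) :=
    min_eq_left (by linarith [(hU i).2])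
  have hpu : M.clip (U i + M.pull U V i / (2 * d)) ≤ U i := by
    rw [Market.clip, hmin]
    exact max_le (hU i).1 (by linarith)
  refine ⟨hpu, ?_⟩
  have h1 : U i - M.clip (U i + M.pull U V i / (2 * d)) ≤ -(M.pull U V i / (2 * d)) := by
    rw [Market.clip, hmin]
    linarith [le_max_right M.Pmin (U i + M.pull U V i / (2 * d))]
  have h2 : -(M.pull U V i / (2 * d)) * d ≤ -M.pull U V i := by
    have : -(M.pull U V i / (2 * d)) * d = -M.pull U V i / 2 := by field_simp
    linarith
  calc _ ≤ (U i - M.clip (U i + M.pull U V i / (2 * d))) * d :=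
        mul_le_mul_of_nonneg_left hle (by linarith)
    _ ≤ -(M.pull U V i / (2 * d)) * d := mul_le_mul_of_nonneg_right h1 hd.le
    _ ≤ _ := h2

theorem Market.Admissible.le_price_of_pull_nonneg (hM : M.Admissible) (hN : 2 ≤ N)
    (hU : U ∈ M.priceBox N) {v : ℝ} (hv : 0 < v) (hV : v ≤ V i i) (hG : 0 ≤ M.pull U V i) :
    U i ≤ M.price U V i ∧
      (M.price U V i - U i) * (M.c * M.Pmin * v / (2 * M.Pmax)) ≤ M.pull U V i := by
  have hκ := mul_pos hM.c_pos hM.Pmin_pos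
  have hP := hM.Pmax_pos
  have hκv : 0 < M.c * M.Pmin * v / (2 * M.Pmax) := by positivity
  constructor
  · rcases lt_or_ge 0 (M.b * V i i - M.c * othersAvg (V i) i) with hd | hd
    · rw [Market.price_of_pos hd]
      refine le_max_of_le_right (le_min ?_ (hU i).2)
      have : 0 ≤ M.pull U V i / (2 * (M.b * V i i - M.c * othersAvg (V i) i)) := by positivity
      linarith
    · rw [Market.price_of_nonpos hd]; exact (hU i).2
  · rcases le_total (M.pull U V i) (M.c * M.Pmin * v / 2) with hG' | hG'
    · have hle := hM.le_slope hN hU hv hV hG'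
      have hd := hκv.trans_le hle
      rw [Market.price_of_pos hd]
      set d := M.b * V i i - M.c * othersAvg (V i) i
      have hq : 0 ≤ M.pull U V i / (2 * d) := by positivity
      have h1 : M.clip (U i + M.pull U V i / (2 * d)) - U i ≤ M.pull U V i / (2 * d) := by
        have : M.clip (U i + M.pull U V i / (2 * d)) ≤ U i + M.pull U V i / (2 * d) :=
          max_le (by linarith [(hU i).1]) (min_le_left _ _)
        linarith
      calc _ ≤ M.pull U V i / (2 * d) * (M.c * M.Pmin * v / (2 * M.Pmax)) :=
            mul_le_mul_of_nonneg_right h1 hκv.le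
        _ ≤ M.pull U V i / (2 * d) * d := mul_le_mul_of_nonneg_left hle hq
        _ = M.pull U V i / 2 := by field_simp
        _ ≤ _ := by linarith
    -- Here the slope may vanish, but the pull is so large that the trivial bound on the adjustment
    -- suffices.
    · have h1 : M.price U V i - U i ≤ M.Pmax := by
        linarith [(hM.price_mem U V i).2, (hU i).1, hM.Pmin_pos]
      calc _ ≤ M.Pmax * (M.c * M.Pmin * v / (2 * M.Pmax)) :=
            mul_le_mul_of_nonneg_right h1 hκv.le
        _ = M.c * M.Pmin * v / 2 := by field_simp
        _ ≤ _ := hG'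

/-- Lower bound on the upward adjustment when the average covariance is nonnegative. -/
theorem Market.Admissible.min_le_price_sub (hM : M.Admissible)
    (hVb : 0 ≤ othersAvg (V i) i) (hG : 0 ≤ M.pull U V i) :
    min (M.pull U V i / (2 * (M.b * V i i))) (M.Pmax - U i) ≤ M.price U V i - U i := by
  have hb := hM.b_pos
  have hc := hM.c_pos
  rcases lt_or_ge 0 (M.b * V i i - M.c * othersAvg (V i) i) with hd | hd
  · rw [Market.price_of_pos hd]
    have h1 : M.pull U V i / (2 * (M.b * V i i)) ≤
        M.pull U V i / (2 * (M.b * V i i - M.c * othersAvg (V i) i)) :=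
      div_le_div_of_nonneg_left hG (by positivity) (by linarith [mul_nonneg hc.le hVb])
    have h2 : min (U i + M.pull U V i / (2 * (M.b * V i i - M.c * othersAvg (V i) i))) M.Pmax ≤
      M.clip (U i + M.pull U V i / (2 * (M.b * V i i - M.c * othersAvg (V i) i))) :=
      le_max_right _ _
    rcases min_choice (U i + M.pull U V i / (2 * (M.b * V i i - M.c * othersAvg (V i) i))) M.Pmax
      with h | h <;> rw [h] at h2
    · exact (min_le_left _ _).trans (by linarith)
    · exact (min_le_right _ _).trans (by linarith)
  · rw [Market.price_of_nonpos hd]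
    exact min_le_right _ _

theorem Market.lt_price_of_pull_pos (hU' : U i < M.Pmax)
    (hG : 0 < M.pull U V i) : U i < M.price U V i := by
  rcases lt_or_ge 0 (M.b * V i i - M.c * othersAvg (V i) i) with hd | hd
  · rw [Market.price_of_pos hd]
    refine lt_max_of_lt_right (lt_min ?_ hU')
    have : 0 < M.pull U V i / (2 * (M.b * V i i - M.c * othersAvg (V i) i)) := by positivity
    linarith
  · rwa [Market.price_of_nonpos hd]

/-- Upper bound on the upward adjustment when the average covariance is small. -/
theorem Market.Admissible.price_sub_le (hM : M.Admissible) (hU : U ∈ M.priceBox N)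
    (hV : 0 < V i i) (hVb : M.c * othersAvg (V i) i ≤ M.b * V i i / 2) (hG : 0 ≤ M.pull U V i) :
    M.price U V i - U i ≤ M.pull U V i / (M.b * V i i) := by
  have hb := hM.b_pos
  have hbV : 0 < M.b * V i i := by positivity
  have hd : 0 < M.b * V i i - M.c * othersAvg (V i) i := by linarith
  rw [Market.price_of_pos hd]
  have h1 : M.pull U V i / (2 * (M.b * V i i - M.c * othersAvg (V i) i)) ≤
      M.pull U V i / (M.b * V i i) := div_le_div_of_nonneg_left hG hbV (by linarith)
  have h2 : 0 ≤ M.pull U V i / (2 * (M.b * V i i - M.c * othersAvg (V i) i)) := by positivity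
  have : M.clip (U i + M.pull U V i / (2 * (M.b * V i i - M.c * othersAvg (V i) i))) ≤
      U i + M.pull U V i / (2 * (M.b * V i i - M.c * othersAvg (V i) i)) :=
    max_le (by linarith [(hU i).1]) (min_le_left _ _)
  linarith

/-- Competitors above the Nash price and a nonnegative covariance force a supra-Nash price. -/
theorem Market.Admissible.nash_lt_price (hM : M.Admissible) (hU : U ∈ M.priceBox N)
    (hV : 0 < V i i) (hVb : 0 ≤ othersAvg (V i) i) (hUb : M.nash < othersAvg U i) :
    M.nash < M.price U V i := by
  rcases lt_or_ge 0 (M.b * V i i - M.c * othersAvg (V i) i) with hd | hd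
  · rw [Market.price_of_pos hd, ← Market.rawPrice_eq_add_pull hd]
    refine lt_max_of_lt_right (lt_min ?_ hM.nash_lt_Pmax)
    unfold Market.rawPrice
    rw [lt_div_iff₀ (by positivity)]
    -- Numerator minus `nash` times denominator equals `c (Ū - nash) V i i + c (2 nash - U i) V̄`.
    have h1 := hM.nash_mul
    have h2 : 0 < M.c * ((othersAvg U i - M.nash) * V i i) :=
      mul_pos hM.c_pos (mul_pos (by linarith) hV)
    have h3 : 0 ≤ M.c * ((2 * M.nash - U i) * othersAvg (V i) i) :=
      mul_nonneg hM.c_pos.le (mul_nonneg (by linarith [(hU i).2, hM.Pmax_lt_two_nash]) hVb)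
    rw [← h1]
    linarith
  · rw [Market.price_of_nonpos hd]; exact hM.nash_lt_Pmax

end Pull

/-- The adjustment of firm `i`: its posted price minus its running average price. -/
noncomputable def Market.adj (M : Market) {N : ℕ} (U : Fin N → ℝ) (V : Matrix (Fin N) (Fin N) ℝ)
    (i : Fin N) : ℝ :=
  M.price U V i - U i

/-- The adjustment has the sign of the pull and is dominated by it. -/
theorem Market.Admissible.sign_adj {M : Market} (hM : M.Admissible) {N : ℕ} (hN : 2 ≤ N)
    {U : Fin N → ℝ} {V : Matrix (Fin N) (Fin N) ℝ} {i : Fin N} (hU : U ∈ M.priceBox N) {v : ℝ}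
    (hv : 0 < v) (hV : v ≤ V i i) {s : ℝ} (hs : s = 1 ∨ s = -1) (hG : 0 ≤ s * M.pull U V i) :
    0 ≤ s * M.adj U V i ∧
      s * M.adj U V i * (M.c * M.Pmin * v / (2 * M.Pmax)) ≤ s * M.pull U V i := by
  unfold Market.adj
  rcases hs with rfl | rfl
  · rw [one_mul] at hG
    have := hM.le_price_of_pull_nonneg hN hU hv hV hG
    exact ⟨by linarith [this.1], by linarith [this.2]⟩
  · have := hM.price_le_of_pull_nonpos hN hU hv hV (by linarith)
    exact ⟨by linarith [this.1], by linarith [this.2]⟩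

/-! ### Sign invariance of the pulls, and the upper cone. -/

section Dynamics

variable {M : Market} {N : ℕ} {μ : Fin N → ℝ} {S : Matrix (Fin N) (Fin N) ℝ}
  {U : ℝ → Fin N → ℝ} {V : ℝ → Matrix (Fin N) (Fin N) ℝ}

theorem Market.IsSolution.hasDerivWithinAt_othersAvg_U (h : M.IsSolution μ S U V) {τ : ℝ}
    (hτ : 1 ≤ τ) (i : Fin N) :
    HasDerivWithinAt (fun t => othersAvg (U t) i) (othersAvg (M.adj (U τ) (V τ)) i / τ)
      (Ici 1) τ := by
  rw [← othersAvg_div]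
  exact hasDerivWithinAt_othersAvg (fun j => h.deriv_U τ hτ j) i

theorem Market.IsSolution.hasDerivWithinAt_othersAvg_V (h : M.IsSolution μ S U V) {τ : ℝ}
    (hτ : 1 ≤ τ) (i : Fin N) :
    HasDerivWithinAt (fun t => othersAvg (V t i) i)
      (M.adj (U τ) (V τ) i * othersAvg (M.adj (U τ) (V τ)) i) (Ici 1) τ := by
  rw [← othersAvg_const_mul]
  exact hasDerivWithinAt_othersAvg (fun j => h.deriv_V τ hτ i j) i

theorem Market.IsSolution.hasDerivWithinAt_pull (h : M.IsSolution μ S U V) {τ : ℝ}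
    (hτ : 1 ≤ τ) (i : Fin N) :
    HasDerivWithinAt (fun t => M.pull (U t) (V t) i)
      (M.c * othersAvg (M.adj (U τ) (V τ)) i * V τ i i / τ + M.adj (U τ) (V τ) i *
        (-2 * M.b * V τ i i / τ
          + (M.a + M.c * othersAvg (U τ) i - 2 * M.b * U τ i) * M.adj (U τ) (V τ) i
          + M.c * othersAvg (V τ i) i / τ + M.c * U τ i * othersAvg (M.adj (U τ) (V τ)) i))
      (Ici 1) τ := by
  have hU := h.deriv_U τ hτ i
  have hV := h.deriv_V τ hτ i i
  have hUb := h.hasDerivWithinAt_othersAvg_U hτ i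
  have hVb := h.hasDerivWithinAt_othersAvg_V hτ i
  convert! ((((hUb.const_mul M.c).const_add M.a).fun_sub (hU.const_mul (2 * M.b))).mul hV).add
    ((hU.const_mul M.c).mul hVb) using 1
  unfold Market.adj
  ring

theorem Market.IsSolution.continuousOn_V (h : M.IsSolution μ S U V) (i j : Fin N) :
    ContinuousOn (fun t => V t i j) (Ici 1) := fun t ht =>
  (h.deriv_V t ht i j).continuousWithinAt

theorem Market.Admissible.abs_adj_le (hM : M.Admissible) {U : Fin N → ℝ}
    (V : Matrix (Fin N) (Fin N) ℝ) (hU : U ∈ M.priceBox N) (i : Fin N) :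
    |M.adj U V i| ≤ M.Pmax := by
  have h1 := hM.price_mem U V i
  have h2 := hU i
  have h3 := hM.Pmin_pos
  exact abs_le.mpr ⟨by unfold Market.adj; linarith [h1.1, h2.2],
    by unfold Market.adj; linarith [h1.2, h2.1]⟩

/-- On a compact time interval the coefficient of the adjustment in the derivative of the pull is
bounded. -/
theorem Market.IsSolution.exists_pull_coeff_bound (hM : M.Admissible) (hN : 2 ≤ N)
    (hμ : μ ∈ M.priceBox N) (h : M.IsSolution μ S U V) (T : ℝ) (i : Fin N) :
    ∃ C : ℝ, ∀ τ ∈ Icc 1 T, |(-2 * M.b * V τ i i / τ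
          + (M.a + M.c * othersAvg (U τ) i - 2 * M.b * U τ i) * M.adj (U τ) (V τ) i
          + M.c * othersAvg (V τ i) i / τ + M.c * U τ i * othersAvg (M.adj (U τ) (V τ)) i)| ≤ C := by
  have hc := hM.c_pos
  have hb := hM.b_pos
  have hP := hM.Pmax_pos
  have hcont : ContinuousOn (fun τ => -2 * M.b * V τ i i / τ + M.c * othersAvg (V τ i) i / τ)
      (Icc 1 T) := by
    have hne : ∀ τ ∈ Icc (1 : ℝ) T, τ ≠ 0 := fun τ hτ => by linarith [hτ.1]
    have h1 : ContinuousOn (fun t => V t i i) (Icc 1 T) :=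
      (h.continuousOn_V i i).mono Icc_subset_Ici_self
    have h2 : ContinuousOn (fun t => othersAvg (V t i) i) (Icc 1 T) := fun t ht =>
      (h.hasDerivWithinAt_othersAvg_V ht.1 i).continuousWithinAt.mono Icc_subset_Ici_self
    exact ((continuousOn_const.mul h1).div continuousOn_id hne).add
      ((continuousOn_const.mul h2).div continuousOn_id hne)
  obtain ⟨C, hC⟩ := isCompact_Icc.exists_bound_of_continuousOn hcont
  refine ⟨C + (M.a + M.c * M.Pmax + 2 * M.b * M.Pmax) * M.Pmax + M.c * M.Pmax * M.Pmax,
    fun τ hτ => ?_⟩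
  have hU := h.U_mem hM hμ hτ.1
  have hm := hM.Pmin_pos
  have hUb1 : 0 ≤ othersAvg (U τ) i := le_othersAvg hN fun j _ => hm.le.trans (hU j).1
  have hUb2 : othersAvg (U τ) i ≤ M.Pmax := othersAvg_le hN fun j _ => (hU j).2
  have hU1 : 0 ≤ U τ i := hm.le.trans (hU i).1
  have hD : ∀ j, |M.adj (U τ) (V τ) j| ≤ M.Pmax := hM.abs_adj_le (V τ) hU
  have hDb : |othersAvg (M.adj (U τ) (V τ)) i| ≤ M.Pmax :=
    abs_le.mpr ⟨le_othersAvg hN fun j _ => (abs_le.mp (hD j)).1,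
      othersAvg_le hN fun j _ => (abs_le.mp (hD j)).2⟩
  have e1 : |(M.a + M.c * othersAvg (U τ) i - 2 * M.b * U τ i) * M.adj (U τ) (V τ) i| ≤
      (M.a + M.c * M.Pmax + 2 * M.b * M.Pmax) * M.Pmax := by
    rw [abs_mul]
    have ha := hM.a_pos
    have q1 := mul_le_mul_of_nonneg_left hUb2 hc.le
    have q2 := mul_le_mul_of_nonneg_left (hU i).2 hb.le
    have q3 := mul_nonneg hc.le hUb1
    have q4 := mul_nonneg hb.le hU1
    have q5 := mul_pos hb hP
    have q6 := mul_pos hc hP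
    refine mul_le_mul (abs_le.mpr ⟨?_, ?_⟩) (hD i) (abs_nonneg _) ?_ <;> linarith
  have e2 : |M.c * U τ i * othersAvg (M.adj (U τ) (V τ)) i| ≤ M.c * M.Pmax * M.Pmax := by
    rw [abs_mul, abs_of_nonneg (mul_nonneg hc.le hU1)]
    exact mul_le_mul (mul_le_mul_of_nonneg_left (hU i).2 hc.le) hDb (abs_nonneg _) (by positivity)
  have e3 := hC τ hτ
  rw [Real.norm_eq_abs] at e3
  rw [abs_le] at e1 e2 e3 ⊢
  constructor <;> linarith [e1.1, e1.2, e2.1, e2.2, e3.1, e3.2]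

variable {σ : Fin N → ℝ}

/-- The regions where all pulls are positive, or all are negative, are forward invariant. -/
theorem Market.IsSolution.pull_sign_invariant (hM : M.Admissible) (hN : 2 ≤ N)
    (hμ : μ ∈ M.priceBox N) (hσ : ∀ i, 0 < σ i)
    (h : M.IsSolution μ (Matrix.diagonal fun i => σ i ^ 2) U V) {s : ℝ} (hs : s = 1 ∨ s = -1)
    (h1 : ∀ i, 0 < s * M.pull (U 1) (V 1) i) :
    ∀ τ, 1 ≤ τ → ∀ i, 0 < s * M.pull (U τ) (V τ) i := by
  have hV : ∀ τ, 1 ≤ τ → ∀ i, σ i ^ 2 ≤ V τ i i := fun τ hτ i => by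
    simpa using h.le_V_diag hτ i
  have habs : |s| = 1 := by rcases hs with rfl | rfl <;> simp
  refine forall_pos_of_no_first_zero (f := fun i t => s * M.pull (U t) (V t) i)
    (fun i t ht => ((h.hasDerivWithinAt_pull ht i).const_mul s).continuousWithinAt) h1 ?_
  intro T hT hpos _ i
  obtain ⟨C, hC⟩ := h.exists_pull_coeff_bound hM hN hμ T i
  have hsign := fun (t : ℝ) (ht : t ∈ Ico 1 T) (j : Fin N) =>
    hM.sign_adj hN (h.U_mem hM hμ ht.1) (pow_pos (hσ j) 2) (hV t ht.1 j) hs (hpos t ht j).le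
  set κ := M.c * M.Pmin * σ i ^ 2 / (2 * M.Pmax) with hκ
  have hκ0 : 0 < κ := by
    have := hM.c_pos; have := hM.Pmin_pos; have := hM.Pmax_pos; have := hσ i; positivity
  refine pos_of_neg_mul_le_deriv (f := fun t => s * M.pull (U t) (V t) i) (C := C / κ) hT (h1 i)
    (fun t ht => ((h.hasDerivWithinAt_pull ht.1 i).const_mul s).mono Icc_subset_Ici_self) ?_
  intro t ht
  have htI : t ∈ Ico 1 T := Ioo_subset_Ico_self ht
  have hb := hC t ⟨htI.1, htI.2.le⟩
  set R := -2 * M.b * V t i i / t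
          + (M.a + M.c * othersAvg (U t) i - 2 * M.b * U t i) * M.adj (U t) (V t) i
          + M.c * othersAvg (V t i) i / t + M.c * U t i * othersAvg (M.adj (U t) (V t)) i
  have hC0 : 0 ≤ C := (abs_nonneg R).trans hb
  have hD := hsign t htI i
  have hDbar : 0 ≤ s * othersAvg (M.adj (U t) (V t)) i := by
    rw [← othersAvg_const_mul]
    exact le_othersAvg hN fun j _ => (hsign t htI j).1
  have ht0 : 0 < t := by linarith [htI.1]
  have hVt : 0 ≤ V t i i := (sq_nonneg _).trans (hV t htI.1 i)
  -- The competitors' adjustments push the pull in the favourable direction; only the term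
  -- proportional to the own adjustment must be controlled.
  have e1 : 0 ≤ M.c * (s * othersAvg (M.adj (U t) (V t)) i) * V t i i / t := by
    have := hM.c_pos; positivity
  have e2 : s * M.adj (U t) (V t) i ≤ s * M.pull (U t) (V t) i / κ :=
    (le_div_iff₀ hκ0).mpr hD.2
  have e3 : -(s * M.pull (U t) (V t) i / κ * C) ≤ s * M.adj (U t) (V t) i * R := by
    have := mul_le_mul e2 hb (abs_nonneg R) (hD.1.trans e2)
    have := mul_le_mul_of_nonneg_left (neg_abs_le R) hD.1
    linarith
  calc -(C / κ) * (s * M.pull (U t) (V t) i) = -(s * M.pull (U t) (V t) i / κ * C) := by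
        field_simp
    _ ≤ M.c * (s * othersAvg (M.adj (U t) (V t)) i) * V t i i / t
        + s * M.adj (U t) (V t) i * R := by linarith
    _ = _ := by ring

/-- With no initial covariance the pull is the best-response gap times the variance, so the two
cones become sign conditions on the pulls. -/
theorem pull_diagonal (M : Market) (μ : Fin N → ℝ) (σ : Fin N → ℝ) (i : Fin N) :
    M.pull μ (Matrix.diagonal fun i => σ i ^ 2) i =
      (M.a + M.c * othersAvg μ i - 2 * M.b * μ i) * σ i ^ 2 := by
  have : othersAvg ((Matrix.diagonal fun i => σ i ^ 2 : Matrix (Fin N) (Fin N) ℝ) i) i = 0 := by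
    unfold othersAvg
    rw [Finset.sum_eq_zero, zero_div]
    intro j hj
    exact Matrix.diagonal_apply_ne' _ (Finset.ne_of_mem_erase hj)
  simp [Market.pull, this]

/-- If the adjustments keep a common sign, the covariances are nonnegative. -/
theorem Market.IsSolution.othersAvg_V_nonneg (hN : 2 ≤ N)
    (h : M.IsSolution μ (Matrix.diagonal fun i => σ i ^ 2) U V) {s : ℝ} (hs : s = 1 ∨ s = -1)
    (hD : ∀ τ, 1 ≤ τ → ∀ i, 0 ≤ s * M.adj (U τ) (V τ) i) {τ : ℝ} (hτ : 1 ≤ τ) (i : Fin N) :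
    0 ≤ othersAvg (V τ i) i := by
  refine le_othersAvg hN fun j hj => ?_
  have hss : s * s = 1 := by rcases hs with rfl | rfl <;> norm_num
  have := monotoneOn_Ici_of_hasDerivWithinAt_nonneg (fun t ht => h.deriv_V t ht i j)
    (fun t ht => by
      have h2 := mul_nonneg (hD t ht i) (hD t ht j)
      have h3 : s * M.adj (U t) (V t) i * (s * M.adj (U t) (V t) j) =
        s * s * (M.adj (U t) (V t) i * M.adj (U t) (V t) j) := by ring
      rw [h3, hss, one_mul] at h2
      exact h2) self_mem_Ici hτ hτ
  simpa [h.init_V, Matrix.diagonal_apply_ne' _ hj] using this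

/-- In the upper best-response region all prices exceed the Nash price. -/
theorem Market.Admissible.nash_lt_of_forall_lt (hM : M.Admissible) (hN : 2 ≤ N) {x : Fin N → ℝ}
    (hx : ∀ i, M.a + M.c * othersAvg x i < 2 * M.b * x i) (i : Fin N) : M.nash < x i := by
  have : Nonempty (Fin N) := ⟨i⟩
  obtain ⟨k, hk⟩ := Finite.exists_min x
  refine lt_of_lt_of_le ?_ (hk i)
  have h1 := mul_le_mul_of_nonneg_left
    (le_othersAvg hN (i := k) fun j _ => hk j) hM.c_pos.le
  have h2 := hx k
  unfold Market.nash
  rw [div_lt_iff₀ (by linarith [hM.c_pos, hM.c_lt_b])]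
  linarith

/-- In the lower best-response region all prices are below the Nash price. -/
theorem Market.Admissible.lt_nash_of_forall_lt (hM : M.Admissible) (hN : 2 ≤ N) {x : Fin N → ℝ}
    (hx : ∀ i, 2 * M.b * x i < M.a + M.c * othersAvg x i) (i : Fin N) : x i < M.nash := by
  have : Nonempty (Fin N) := ⟨i⟩
  obtain ⟨k, hk⟩ := Finite.exists_max x
  refine lt_of_le_of_lt (hk i) ?_
  have h1 := mul_le_mul_of_nonneg_left
    (othersAvg_le hN (i := k) fun j _ => hk j) hM.c_pos.le
  have h2 := hx k
  unfold Market.nash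
  rw [lt_div_iff₀ (by linarith [hM.c_pos, hM.c_lt_b])]
  linarith

/-- Started in the upper best-response cone, the posted prices stay above the Nash price. -/
theorem Market.IsSolution.nash_lt_price_of_upperCone (hM : M.Admissible) (hN : 2 ≤ N)
    (hσ : ∀ i, 0 < σ i) (h : M.IsSolution μ (Matrix.diagonal fun i => σ i ^ 2) U V)
    (hμ : μ ∈ M.upperCone N) {τ : ℝ} (hτ : 1 ≤ τ) (i : Fin N) :
    M.nash < M.price (U τ) (V τ) i := by
  have hb := hM.b_pos
  have hV : ∀ τ, 1 ≤ τ → ∀ i, σ i ^ 2 ≤ V τ i i := fun τ hτ i => by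
    simpa using h.le_V_diag hτ i
  have hs : (-1 : ℝ) = 1 ∨ (-1 : ℝ) = -1 := Or.inr rfl
  have hpull := h.pull_sign_invariant hM hN hμ.1 hσ hs fun i => by
    rw [h.init_U, h.init_V, pull_diagonal, neg_one_mul, neg_pos]
    refine mul_neg_of_neg_of_pos ?_ (pow_pos (hσ i) 2)
    have := hμ.2 i
    rw [Market.BR, div_lt_iff₀ (by positivity)] at this
    linarith
  have hVb := h.othersAvg_V_nonneg hN hs (fun t ht j =>
    (hM.sign_adj hN (h.U_mem hM hμ.1 ht) (pow_pos (hσ j) 2) (hV t ht j) hs (hpull t ht j).le).1) hτ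
  have hU := h.U_mem hM hμ.1 hτ
  have hV0 : ∀ i, 0 < V τ i i := fun i => (pow_pos (hσ i) 2).trans_le (hV τ hτ i)
  refine hM.nash_lt_price hU (hV0 i) (hVb i) (lt_othersAvg hN fun j _ => ?_)
  refine hM.nash_lt_of_forall_lt hN (fun k => ?_) j
  have h1 := hpull τ hτ k
  -- The covariance term of the negative pull is nonnegative, so the best-response gap itself is
  -- negative.
  have h2 : 0 ≤ M.c * U τ k * othersAvg (V τ k) k :=
    mul_nonneg (mul_nonneg hM.c_pos.le (hM.Pmin_pos.le.trans (hU k).1)) (hVb k)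
  unfold Market.pull at h1
  have h3 : (M.a + M.c * othersAvg (U τ) k - 2 * M.b * U τ k) * V τ k k < 0 := by linarith
  linarith [neg_of_mul_neg_left h3 (hV0 k).le]

end Dynamics

end PriceMoments

/-! ### Monotone limits, averages, and estimates below the Nash price. -/

theorem exists_tendsto_of_monotoneOn_Ici {f : ℝ → ℝ} {s B : ℝ} (hf : MonotoneOn f (Ici s))
    (hB : ∀ t, s ≤ t → f t ≤ B) : ∃ L, Tendsto f atTop (𝓝 L) ∧ ∀ t, s ≤ t → f t ≤ L := by
  have hmono : Monotone fun t => f (max t s) := fun x y hxy =>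
    hf (mem_Ici.mpr (le_max_right _ _)) (mem_Ici.mpr (le_max_right _ _)) (max_le_max_right s hxy)
  have hbdd : BddAbove (range fun t => f (max t s)) :=
    ⟨B, by rintro _ ⟨t, rfl⟩; exact hB _ (le_max_right _ _)⟩
  refine ⟨_, (tendsto_atTop_ciSup hmono hbdd).congr' ?_, fun t ht => ?_⟩
  · filter_upwards [eventually_ge_atTop s] with t ht
    rw [max_eq_left ht]
  · have := le_ciSup hbdd t
    simpa [max_eq_left ht] using this

namespace PriceMoments

section Averages

variable {N : ℕ}

theorem le_of_othersAvg_le (hN : 2 ≤ N) {x : Fin N → ℝ} {i : Fin N} {r : ℝ}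
    (hx : ∀ j, j ≠ i → r ≤ x j) (h : othersAvg x i ≤ r) {j : Fin N} (hj : j ≠ i) : x j ≤ r := by
  have h1 : (2 : ℝ) ≤ N := by exact_mod_cast hN
  have h2 : othersAvg (fun j => x j - r) i ≤ 0 := by
    have := othersAvg_sub x (fun _ => r) i
    rw [othersAvg_const hN] at this
    linarith
  unfold othersAvg at h2
  rw [div_le_iff₀ (by linarith), zero_mul] at h2
  have h3 := Finset.single_le_sum (f := fun j => x j - r) (s := Finset.univ.erase i)
    (fun k hk => sub_nonneg.mpr (hx k (Finset.ne_of_mem_erase hk)))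
    (Finset.mem_erase.mpr ⟨hj, Finset.mem_univ j⟩)
  linarith

/-- Each entry occurs in `N - 1` averages with weight `1 / (N - 1)`. -/
theorem sum_othersAvg (hN : 2 ≤ N) (x : Fin N → ℝ) : ∑ i, othersAvg x i = ∑ i, x i := by
  have h1 : (2 : ℝ) ≤ N := by exact_mod_cast hN
  unfold othersAvg
  rw [← Finset.sum_div, div_eq_iff (by linarith)]
  simp only [Finset.sum_erase_eq_sub (Finset.mem_univ _), Finset.sum_sub_distrib,
    Finset.sum_const, Finset.card_univ, Fintype.card_fin, nsmul_eq_mul]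
  ring

theorem othersAvg_le_sum (hN : 2 ≤ N) {x : Fin N → ℝ} (hx : ∀ j, 0 ≤ x j) (i : Fin N) :
    othersAvg x i ≤ ∑ j, x j :=
  othersAvg_le hN fun j _ => Finset.single_le_sum (fun k _ => hx k) (Finset.mem_univ j)

theorem tendsto_othersAvg {X : Type*} {l : Filter X} {x : X → Fin N → ℝ} {y : Fin N → ℝ}
    (h : ∀ j, Tendsto (fun t => x t j) l (𝓝 (y j))) (i : Fin N) :
    Tendsto (fun t => othersAvg (x t) i) l (𝓝 (othersAvg y i)) :=
  (tendsto_finsetSum _ fun j _ => h j).div_const _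

end Averages

section Static

variable {M : Market} {N : ℕ} {U : Fin N → ℝ} {V : Matrix (Fin N) (Fin N) ℝ} {i : Fin N}

/-- The best-response gap in terms of the deviations from the Nash price. -/
theorem Market.Admissible.gap_eq (hM : M.Admissible) (hN : 2 ≤ N) (U : Fin N → ℝ) (i : Fin N) :
    M.a + M.c * othersAvg U i - 2 * M.b * U i =
      2 * M.b * (M.nash - U i) - M.c * othersAvg (fun j => M.nash - U j) i := by
  have h := othersAvg_sub (fun _ => M.nash) U i
  rw [othersAvg_const hN] at h
  rw [h, ← hM.nash_mul]
  ring

/-- Lower bound on the adjustment from a lower bound `ρ` on the regression coefficient. -/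
theorem Market.Admissible.min_le_adj (hM : M.Admissible) (hU : U ∈ M.priceBox N)
    (hV : 0 < V i i) (hG : 0 < M.pull U V i) {ρ : ℝ} (hρ0 : 0 ≤ ρ)
    (hρ : ρ * V i i ≤ othersAvg (V i) i) :
    min ((M.a + M.c * othersAvg U i - 2 * M.b * U i + M.c * U i * ρ) / (2 * M.b)) (M.Pmax - U i) ≤
      M.adj U V i := by
  have hb := hM.b_pos
  have h0 : 0 ≤ othersAvg (V i) i := (mul_nonneg hρ0 hV.le).trans hρ
  refine le_trans (min_le_min_right _ ?_) (hM.min_le_price_sub h0 hG.le)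
  rw [div_le_div_iff₀ (by positivity) (by positivity)]
  have h1 : M.c * U i * (ρ * V i i) ≤ M.c * U i * othersAvg (V i) i :=
    mul_le_mul_of_nonneg_left hρ (mul_nonneg hM.c_pos.le (hM.Pmin_pos.le.trans (hU i).1))
  unfold Market.pull
  have h2 := mul_le_mul_of_nonneg_left h1 (show 0 ≤ 2 * M.b by positivity)
  linarith

/-- Below the Nash price, the total adjustment dominates the total deviation. -/
theorem Market.Admissible.le_sum_adj (hM : M.Admissible) (hN : 2 ≤ N) (hU : U ∈ M.priceBox N)
    (hUn : ∀ i, U i ≤ M.nash) (hV : ∀ i, 0 < V i i) (hVb : ∀ i, 0 ≤ othersAvg (V i) i)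
    (hG : ∀ i, 0 < M.pull U V i) :
    (1 - M.c / (2 * M.b)) * ∑ i, (M.nash - U i) ≤ ∑ i, M.adj U V i := by
  have hb := hM.b_pos
  have hc := hM.c_pos
  -- This is `min_le_adj` with `ρ = 0`; summing over firms turns the averages back into the total
  -- deviation.
  have hi : ∀ i, (M.nash - U i) - M.c / (2 * M.b) * othersAvg (fun j => M.nash - U j) i ≤
      M.adj U V i := by
    intro i
    have havg : 0 ≤ othersAvg (fun j => M.nash - U j) i :=
      le_othersAvg hN fun j _ => sub_nonneg.mpr (hUn j)
    refine le_trans (le_min ?_ ?_) (hM.min_le_adj hU (hV i) (hG i) le_rfl (by simpa using hVb i))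
    · rw [hM.gap_eq hN]
      apply le_of_eq
      field_simp
      ring
    · have h1 : 0 ≤ M.c / (2 * M.b) * othersAvg (fun j => M.nash - U j) i := by positivity
      have h2 : M.nash < M.Pmax := hM.nash_lt_Pmax
      linarith
  refine le_trans (le_of_eq ?_) (Finset.sum_le_sum fun i _ => hi i)
  rw [Finset.sum_sub_distrib (fun i => M.nash - U i), ← Finset.mul_sum, sum_othersAvg hN]
  ring

/-- Below the Nash price, if all regression coefficients are at least a small `ρ` and that of firm
`i` equals `ρ`, then either the coefficient of `i` is increasing or the adjustment of `i` is
controlled by the total deviation from the Nash price. -/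
theorem Market.Admissible.adj_dichotomy (hM : M.Admissible) (hN : 2 ≤ N) (hU : U ∈ M.priceBox N)
    (hUn : ∀ j, U j ≤ M.nash) (hV : ∀ j, 0 < V j j) (hG : ∀ j, 0 < M.pull U V j)
    {ρ q : ℝ} (hq : q = M.c * M.Pmin / (2 * M.b)) (hρ : 0 < ρ) (hρc : M.c * ρ ≤ M.b / 2)
    (hρP : q * ρ ≤ M.Pmax - M.nash) (hρn : M.nash * ρ ≤ q / 4) (hρ2 : 2 * ρ ≤ 1)
    (hVb : ∀ j, ρ * V j j ≤ othersAvg (V j) j) (hi : othersAvg (V i) i = ρ * V i i) :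
    ρ * M.adj U V i < othersAvg (M.adj U V) i ∨
      (0 < ∑ j, (M.nash - U j) ∧ M.adj U V i ≤ (2 + 4 * M.nash / q) * ∑ j, (M.nash - U j)) := by
  have hb := hM.b_pos
  have hc := hM.c_pos
  have hn := hM.nash_pos
  have hm := hM.Pmin_pos
  have hq0 : 0 < q := by rw [hq]; positivity
  have he : ∀ j, 0 ≤ M.nash - U j := fun j => sub_nonneg.mpr (hUn j)
  set E := ∑ j, (M.nash - U j) with hE
  have hE0 : 0 ≤ E := Finset.sum_nonneg fun j _ => he j
  have heE : ∀ j, M.nash - U j ≤ E := fun j =>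
    Finset.single_le_sum (f := fun j => M.nash - U j) (fun k _ => he k) (Finset.mem_univ j)
  have havg0 : ∀ j, 0 ≤ othersAvg (fun j => M.nash - U j) j := fun j =>
    le_othersAvg hN fun k _ => he k
  have havg : ∀ j, othersAvg (fun j => M.nash - U j) j ≤ E := fun j => othersAvg_le_sum hN he j
  -- The covariance contributes at least `q * ρ`, and the best-response gap costs at most `E`.
  have hlow : ∀ j, q * ρ - E ≤ M.adj U V j := by
    intro j
    refine le_trans (le_min ?_ ?_) (hM.min_le_adj hU (hV j) (hG j) hρ.le (hVb j))
    · rw [hM.gap_eq hN, le_div_iff₀ (by positivity)]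
      have e1 : q * (2 * M.b) = M.c * M.Pmin := by rw [hq]; field_simp
      have e2 : M.c * M.Pmin * ρ ≤ M.c * U j * ρ :=
        mul_le_mul_of_nonneg_right (mul_le_mul_of_nonneg_left (hU j).1 hc.le) hρ.le
      have e3 := mul_nonneg hb.le (he j)
      have e4 := mul_le_mul_of_nonneg_left (havg j) hc.le
      have e5 := mul_le_mul_of_nonneg_right hM.c_lt_b.le hE0
      have e6 := mul_nonneg hb.le hE0
      have e7 : (q * ρ - E) * (2 * M.b) = q * (2 * M.b) * ρ - 2 * (M.b * E) := by ring
      rw [e7, e1]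
      linarith
    · linarith [hUn j]
  have hup : M.adj U V i ≤ 2 * E + M.nash * ρ := by
    refine (hM.price_sub_le hU (hV i) ?_ (hG i).le).trans ?_
    · rw [hi]
      have := mul_le_mul_of_nonneg_right hρc (hV i).le
      linarith
    · have hbV : 0 < M.b * V i i := mul_pos hb (hV i)
      rw [div_le_iff₀ hbV]
      unfold Market.pull
      rw [hi, hM.gap_eq hN]
      have e1 := mul_le_mul_of_nonneg_left (heE i) hb.le
      have e2 := mul_nonneg hc.le (havg0 i)
      have e3 : M.c * U i * ρ ≤ M.b * M.nash * ρ :=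
        mul_le_mul_of_nonneg_right
          (mul_le_mul hM.c_lt_b.le (hUn i) (hm.le.trans (hU i).1) hb.le) hρ.le
      have e4 : 2 * M.b * (M.nash - U i) - M.c * othersAvg (fun j => M.nash - U j) i +
          M.c * U i * ρ ≤ (2 * E + M.nash * ρ) * M.b := by linarith
      have := mul_le_mul_of_nonneg_right e4 (hV i).le
      linarith
  -- For small `E`, the competitors' average is at least `3 * q * ρ / 4`, while `ρ * adj i ≤ q * ρ /
  -- 2`. Otherwise `ρ < 4 * E / q`, and `hup` is linear in `E`.
  rcases le_or_gt E (q * ρ / 4) with hEq | hEq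
  · left
    have h1 : q * ρ - E ≤ othersAvg (M.adj U V) i := le_othersAvg hN fun j _ => hlow j
    have h2 := mul_le_mul_of_nonneg_left hup hρ.le
    have h3 := mul_le_mul_of_nonneg_right hρn hρ.le
    have h4 := mul_le_mul_of_nonneg_right hρ2 hE0
    have h5 := mul_pos hq0 hρ
    linarith
  · right
    refine ⟨lt_of_le_of_lt (by positivity) hEq, hup.trans ?_⟩
    have h1 : M.nash * ρ ≤ 4 * M.nash / q * E := by
      rw [div_mul_eq_mul_div, le_div_iff₀ hq0]
      have := mul_le_mul_of_nonneg_left hEq.le hn.le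
      linarith
    linarith

end Static

/-! ### The lower cone: monotone averages and their limits. -/

section LowerCone

variable {M : Market} {N : ℕ} {μ σ : Fin N → ℝ}
  {U : ℝ → Fin N → ℝ} {V : ℝ → Matrix (Fin N) (Fin N) ℝ}

/-- `τ * (Pmax - U i)` is nondecreasing. Strictness leaves room for a strictly positive adjustment.
-/
theorem Market.IsSolution.U_lt_Pmax {S : Matrix (Fin N) (Fin N) ℝ} (hM : M.Admissible)
    (h : M.IsSolution μ S U V) {i : Fin N} (hi : μ i < M.Pmax) {τ : ℝ} (hτ : 1 ≤ τ) :
    U τ i < M.Pmax := by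
  have hmono := monotoneOn_Ici_of_hasDerivWithinAt_nonneg (f := fun t => t * M.Pmax - t * U t i)
    (f' := fun t => 1 * M.Pmax - M.price (U t) (V t) i)
    (fun t ht => ((hasDerivWithinAt_id t _).mul_const _).sub (h.hasDerivWithinAt_mul_U ht i))
    (fun t _ => by linarith [(hM.price_mem (U t) (V t) i).2]) self_mem_Ici hτ hτ
  simp only [h.init_U, one_mul] at hmono
  have h1 : 0 < τ * (M.Pmax - U τ i) := by linarith
  linarith [pos_of_mul_pos_right h1 (by linarith)]

/-- Started in the lower best-response cone, all pulls and all adjustments stay positive. -/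
theorem Market.IsSolution.pull_pos_of_lowerCone (hM : M.Admissible) (hN : 2 ≤ N)
    (hσ : ∀ i, 0 < σ i) (h : M.IsSolution μ (Matrix.diagonal fun i => σ i ^ 2) U V)
    (hμ : μ ∈ M.lowerCone N) {τ : ℝ} (hτ : 1 ≤ τ) (i : Fin N) :
    0 < M.pull (U τ) (V τ) i ∧ 0 < M.adj (U τ) (V τ) i := by
  have hb := hM.b_pos
  have hgap : ∀ i, 2 * M.b * μ i < M.a + M.c * othersAvg μ i := fun i => by
    have := hμ.2 i
    rw [Market.BR, lt_div_iff₀ (by positivity)] at this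
    linarith
  have hpull := h.pull_sign_invariant hM hN hμ.1 hσ (Or.inl rfl) fun i => by
    rw [h.init_U, h.init_V, pull_diagonal, one_mul]
    exact mul_pos (by linarith [hgap i]) (pow_pos (hσ i) 2)
  have hp := hpull τ hτ i
  rw [one_mul] at hp
  have hlt : U τ i < M.Pmax :=
    h.U_lt_Pmax hM ((hM.lt_nash_of_forall_lt hN hgap i).trans hM.nash_lt_Pmax) hτ
  exact ⟨hp, sub_pos.mpr (M.lt_price_of_pull_pos hlt hp)⟩

theorem Market.IsSolution.monotoneOn_U {S : Matrix (Fin N) (Fin N) ℝ} (h : M.IsSolution μ S U V)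
    (hadj : ∀ τ, 1 ≤ τ → ∀ i, 0 < M.adj (U τ) (V τ) i) (i : Fin N) :
    MonotoneOn (fun t => U t i) (Ici 1) :=
  monotoneOn_Ici_of_hasDerivWithinAt_nonneg (fun t ht => h.deriv_U t ht i)
    (fun t ht => div_nonneg (hadj t ht i).le (by linarith))

/-- Since `U` is bounded, no adjustment is eventually bounded away from zero. -/
theorem Market.IsSolution.not_eventually_le_adj {S : Matrix (Fin N) (Fin N) ℝ}
    (hM : M.Admissible) (hμ : μ ∈ M.priceBox N) (h : M.IsSolution μ S U V) (i : Fin N) {δ : ℝ}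
    (hδ : 0 < δ) : ¬ ∀ᶠ τ in atTop, δ ≤ M.adj (U τ) (V τ) i := by
  intro hev
  obtain ⟨T, hT⟩ := eventually_atTop.mp (hev.and (eventually_ge_atTop 1))
  have hT1 : 1 ≤ T := (hT T le_rfl).2
  -- `U' = adj / τ`, so an adjustment of at least `δ` makes `U` grow at least like `δ * log τ`.
  have hmono : MonotoneOn (fun t => U t i - δ * Real.log t) (Ici T) := by
    refine monotoneOn_Ici_of_hasDerivWithinAt_nonneg
      (f' := fun t => M.adj (U t) (V t) i / t - δ * t⁻¹) (fun t ht => ?_) (fun t ht => ?_)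
    · have ht1 := hT1.trans ht
      exact ((h.deriv_U t ht1 i).mono (Ici_subset_Ici.mpr hT1)).sub
        ((Real.hasDerivAt_log (by positivity)).hasDerivWithinAt.const_mul δ)
    · have ht0 : 0 < t := by linarith
      rw [← div_eq_mul_inv, ← sub_div]
      exact div_nonneg (sub_nonneg.mpr (hT t ht).1) ht0.le
  have hlog := (Real.tendsto_log_atTop.const_mul_atTop hδ).eventually_gt_atTop
    (M.Pmax - (U T i - δ * Real.log T))
  obtain ⟨t, ht, htT⟩ := (hlog.and (eventually_ge_atTop T)).exists
  have h1 := hmono self_mem_Ici htT htT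
  have h2 := (h.U_mem hM hμ (hT1.trans htT) i).2
  simp only at h1
  linarith

/-- If the running averages never all exceed the Nash price, they all converge to it from below. -/
theorem Market.IsSolution.tendsto_nash (hM : M.Admissible) (hN : 2 ≤ N) (hσ : ∀ i, 0 < σ i)
    (hμ : μ ∈ M.priceBox N) (h : M.IsSolution μ (Matrix.diagonal fun i => σ i ^ 2) U V)
    (hpull : ∀ τ, 1 ≤ τ → ∀ i, 0 < M.pull (U τ) (V τ) i)
    (hadj : ∀ τ, 1 ≤ τ → ∀ i, 0 < M.adj (U τ) (V τ) i)
    (hnot : ¬ ∃ τ, 1 ≤ τ ∧ ∀ i, M.nash < U τ i) (i : Fin N) :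
    Tendsto (fun t => U t i) atTop (𝓝 M.nash) ∧ ∀ τ, 1 ≤ τ → U τ i ≤ M.nash := by
  have hb := hM.b_pos
  have hc := hM.c_pos
  choose L hL hUL using fun i => exists_tendsto_of_monotoneOn_Ici (h.monotoneOn_U hadj i)
    (fun t ht => (h.U_mem hM hμ ht i).2)
  have : Nonempty (Fin N) := ⟨i⟩
  -- The smallest limit decides: a limiting gap `> 0` would keep the adjustment of `k` away from
  -- zero, and a gap `≤ 0` with `L k` minimal gives `L k ≥ nash`. Equality then forces the
  -- competitors' average, hence every limit, down to `nash`.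
  obtain ⟨k, hk⟩ := Finite.exists_min L
  have hVb : ∀ t, 1 ≤ t → ∀ j, 0 ≤ othersAvg (V t j) j := fun t ht =>
    h.othersAvg_V_nonneg hN (Or.inl rfl) (fun t ht j => by rw [one_mul]; exact (hadj t ht j).le) ht
  have hkn : L k ≤ M.nash := by
    by_contra! hlt
    refine hnot ?_
    have hev : ∀ᶠ t in atTop, ∀ j, M.nash < U t j :=
      eventually_all.mpr fun j => (hL j).eventually_const_lt (hlt.trans_le (hk j))
    obtain ⟨t, ht, ht1⟩ := (hev.and (eventually_ge_atTop 1)).exists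
    exact ⟨t, ht1, ht⟩
  have hgap : M.a + M.c * othersAvg L k - 2 * M.b * L k ≤ 0 := by
    by_contra! hpos
    set γ := M.a + M.c * othersAvg L k - 2 * M.b * L k
    have hlim : Tendsto (fun t => M.a + M.c * othersAvg (U t) k - 2 * M.b * U t k) atTop (𝓝 γ) :=
      (((tendsto_othersAvg hL k).const_mul M.c).const_add M.a).sub ((hL k).const_mul (2 * M.b))
    have hPn : 0 < M.Pmax - M.nash := sub_pos.mpr hM.nash_lt_Pmax
    refine h.not_eventually_le_adj hM hμ k (δ := min (γ / 2 / (2 * M.b)) (M.Pmax - M.nash))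
      (lt_min (by positivity) hPn) ?_
    filter_upwards [hlim.eventually_const_lt (half_lt_self hpos), eventually_ge_atTop 1]
      with t ht ht1
    have hV0 : 0 < V t k k := (pow_pos (hσ k) 2).trans_le (by simpa using h.le_V_diag ht1 k)
    refine le_trans (min_le_min ?_ ?_) (hM.min_le_adj (h.U_mem hM hμ ht1) hV0 (hpull t ht1 k)
      le_rfl (by simpa using hVb t ht1 k))
    · gcongr
      linarith
    · linarith [hUL k t ht1]
  have havg := le_othersAvg hN (i := k) (r := L k) fun j _ => hk j
  have hnk : L k = M.nash := by
    refine le_antisymm hkn ?_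
    unfold Market.nash
    rw [div_le_iff₀ (by linarith [hM.c_lt_b])]
    linarith [mul_le_mul_of_nonneg_left havg hc.le]
  have havg' : othersAvg L k ≤ L k := by
    have := hM.nash_mul
    rw [hnk] at hgap ⊢
    exact le_of_mul_le_mul_left (by linarith) hc
  have hLi : L i = M.nash := by
    by_cases hik : i = k
    · rw [hik, hnk]
    · rw [← hnk]
      exact le_antisymm (le_of_othersAvg_le hN (fun j _ => hk j) havg' hik) (hk i)
  exact ⟨hLi ▸ hL i, fun τ hτ => hLi ▸ hUL i τ hτ⟩

end LowerCone

/-! ### Excluding convergence to the Nash price from below. -/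

section NashLimit

variable {M : Market} {N : ℕ} {μ σ : Fin N → ℝ}
  {U : ℝ → Fin N → ℝ} {V : ℝ → Matrix (Fin N) (Fin N) ℝ}

/-- The derivative of `τ * E ^ 2`, where `E` is the total deviation from the Nash price. -/
theorem Market.IsSolution.hasDerivWithinAt_mul_sq {S : Matrix (Fin N) (Fin N) ℝ}
    (h : M.IsSolution μ S U V) {τ : ℝ} (hτ : 1 ≤ τ) :
    HasDerivWithinAt (fun t => t * (∑ j, (M.nash - U t j)) ^ 2)
      ((∑ j, (M.nash - U τ j)) ^ 2
        - 2 * (∑ j, (M.nash - U τ j)) * ∑ j, M.adj (U τ) (V τ) j) (Ici 1) τ := by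
  have h0 : τ ≠ 0 := by positivity
  have hE : HasDerivWithinAt (fun t => ∑ j, (M.nash - U t j))
      (∑ j, -(M.adj (U τ) (V τ) j / τ)) (Ici 1) τ :=
    HasDerivWithinAt.fun_sum fun j _ => (h.deriv_U τ hτ j).const_sub M.nash
  convert! (hasDerivWithinAt_id τ (Ici 1)).mul (hE.pow 2) using 1
  rw [Finset.sum_neg_distrib, ← Finset.sum_div]
  simp only [id, Nat.cast_ofNat, Pi.pow_apply]
  field_simp
  ring

/-- The derivative of `τ * E ^ 2` is at most `-(1 - c / b) * E ^ 2` below the Nash price. -/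
theorem Market.Admissible.sq_sub_le (hM : M.Admissible) {U : Fin N → ℝ}
    {V : Matrix (Fin N) (Fin N) ℝ} (hN : 2 ≤ N) (hU : U ∈ M.priceBox N)
    (hUn : ∀ i, U i ≤ M.nash) (hV : ∀ i, 0 < V i i) (hVb : ∀ i, 0 ≤ othersAvg (V i) i)
    (hG : ∀ i, 0 < M.pull U V i) :
    (∑ j, (M.nash - U j)) ^ 2 - 2 * (∑ j, (M.nash - U j)) * ∑ j, M.adj U V j ≤
      -((1 - M.c / M.b) * (∑ j, (M.nash - U j)) ^ 2) := by
  have hb := hM.b_pos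
  have h1 := hM.le_sum_adj hN hU hUn hV hVb hG
  have hE0 : 0 ≤ ∑ j, (M.nash - U j) := Finset.sum_nonneg fun j _ => sub_nonneg.mpr (hUn j)
  have h2 := mul_le_mul_of_nonneg_left h1 hE0
  have h3 : M.c / (2 * M.b) = M.c / M.b / 2 := by field_simp
  rw [h3] at h2
  linarith

/-- The covariances become positive when all adjustments are positive. -/
theorem Market.IsSolution.othersAvg_V_pos (hN : 2 ≤ N)
    (h : M.IsSolution μ (Matrix.diagonal fun i => σ i ^ 2) U V)
    (hadj : ∀ τ, 1 ≤ τ → ∀ i, 0 < M.adj (U τ) (V τ) i) {τ : ℝ} (hτ : 1 < τ) (i : Fin N) :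
    0 < othersAvg (V τ i) i := by
  refine lt_othersAvg hN fun j hj => ?_
  have hmono : StrictMonoOn (fun t => V t i j) (Ici 1) := by
    refine strictMonoOn_of_hasDerivWithinAt_pos (convex_Ici 1) (h.continuousOn_V i j)
      (fun t ht => (h.deriv_V t (interior_subset ht) i j).mono interior_subset) fun t ht => ?_
    exact mul_pos (hadj t (interior_subset ht) i) (hadj t (interior_subset ht) j)
  have := hmono self_mem_Ici hτ.le hτ
  simpa [h.init_V, Matrix.diagonal_apply_ne' _ hj] using this

/-- If the running averages stay below the Nash price, the regression coefficients
`othersAvg (V i) i / V i i` stay bounded away from zero. -/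
theorem Market.IsSolution.exists_le_othersAvg_V (hM : M.Admissible) (hN : 2 ≤ N)
    (hσ : ∀ i, 0 < σ i) (hμ : μ ∈ M.priceBox N)
    (h : M.IsSolution μ (Matrix.diagonal fun i => σ i ^ 2) U V)
    (hpull : ∀ τ, 1 ≤ τ → ∀ i, 0 < M.pull (U τ) (V τ) i)
    (hadj : ∀ τ, 1 ≤ τ → ∀ i, 0 < M.adj (U τ) (V τ) i)
    (hUn : ∀ τ, 1 ≤ τ → ∀ i, U τ i ≤ M.nash) :
    ∃ m > 0, ∀ τ, 2 ≤ τ → ∀ i, m * V τ i i ≤ othersAvg (V τ i) i := by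
  have hb := hM.b_pos
  have hc := hM.c_pos
  have hn := hM.nash_pos
  have : Nonempty (Fin N) := ⟨⟨0, by omega⟩⟩
  have hVσ : ∀ τ, 1 ≤ τ → ∀ i, σ i ^ 2 ≤ V τ i i := fun τ hτ i => by
    simpa using h.le_V_diag hτ i
  have hV0 : ∀ τ, 1 ≤ τ → ∀ i, 0 < V τ i i := fun τ hτ i =>
    (pow_pos (hσ i) 2).trans_le (hVσ τ hτ i)
  have hVb : ∀ t, 1 ≤ t → ∀ j, 0 ≤ othersAvg (V t j) j := fun t ht =>
    h.othersAvg_V_nonneg hN (Or.inl rfl) (fun t ht j => by rw [one_mul]; exact (hadj t ht j).le) ht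
  set E : ℝ → ℝ := fun t => ∑ j, (M.nash - U t j) with hE
  set Q : ℝ → ℝ := fun t => E t ^ 2 - 2 * E t * ∑ j, M.adj (U t) (V t) j with hQdef
  set θ := 1 - M.c / M.b with hθ
  have hθ0 : 0 < θ := sub_pos.mpr ((div_lt_one hb).mpr hM.c_lt_b)
  have hQ : ∀ t, 1 ≤ t → Q t ≤ -(θ * E t ^ 2) := fun t ht =>
    hM.sq_sub_le hN (h.U_mem hM hμ ht) (hUn t ht) (hV0 t ht) (hVb t ht) (hpull t ht)
  have hQd : ∀ t, 1 ≤ t → HasDerivWithinAt (fun t => t * E t ^ 2) (Q t) (Ici 1) t := fun t ht =>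
    h.hasDerivWithinAt_mul_sq ht
  have hdecr : ∀ t, 1 ≤ t → t * E t ^ 2 ≤ E 1 ^ 2 := by
    intro t ht
    have := monotoneOn_Ici_of_hasDerivWithinAt_nonneg (f := fun t => -(t * E t ^ 2))
      (fun t ht => (hQd t ht).neg)
      (fun t ht => by have := hQ t ht; have : 0 ≤ θ * E t ^ 2 := by positivity
                      linarith) self_mem_Ici ht ht
    simp only [one_mul] at this
    linarith
  obtain ⟨k₀, hk₀⟩ := Finite.exists_min fun i => σ i ^ 2
  -- The comparison starts at time `2` because all covariances vanish at time `1`.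
  obtain ⟨k₁, hk₁⟩ := Finite.exists_min fun i => othersAvg (V 2 i) i / V 2 i i
  set q := M.c * M.Pmin / (2 * M.b) with hq
  have hq0 : 0 < q := by have := hM.Pmin_pos; positivity
  set C := 2 + 4 * M.nash / q with hC
  -- `K` makes the decay of the barrier, times the variance, at least `ψ * (C² + 1) * E²`, which
  -- strictly beats the loss `ψ * adj² ≤ ψ * C² * E²` when `E > 0`.
  set K := (C ^ 2 + 1) / (θ * σ k₀ ^ 2) with hK
  have hσ0 : 0 < σ k₀ ^ 2 := pow_pos (hσ k₀) 2
  have hK0 : 0 < K := by positivity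
  have hKθ : K * θ * σ k₀ ^ 2 = C ^ 2 + 1 := by
    rw [hK, mul_assoc]; exact div_mul_cancel₀ _ (by positivity)
  have hρ₁ : 0 < othersAvg (V 2 k₁) k₁ / V 2 k₁ k₁ :=
    div_pos (h.othersAvg_V_pos hN hadj (by norm_num) k₁) (hV0 2 (by norm_num) k₁)
  have hPn : 0 < M.Pmax - M.nash := sub_pos.mpr hM.nash_lt_Pmax
  obtain ⟨r, hr0, hr1, hr2, hr3, hr4, hr5⟩ : ∃ r > 0, M.c * r ≤ M.b / 2 ∧
      q * r ≤ M.Pmax - M.nash ∧ M.nash * r ≤ q / 4 ∧ 2 * r ≤ 1 ∧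
      r < othersAvg (V 2 k₁) k₁ / V 2 k₁ k₁ := by
    have tend : ∀ a : ℝ, Tendsto (fun r => a * r) (𝓝[>] (0 : ℝ)) (𝓝 0) := fun a => by
      have : Tendsto (fun r : ℝ => a * r) (𝓝 0) (𝓝 (a * 0)) := tendsto_id.const_mul a
      rw [mul_zero] at this
      exact this.mono_left nhdsWithin_le_nhds
    have hev := ((tend M.c).eventually_le_const (show 0 < M.b / 2 by positivity)).and
      (((tend q).eventually_le_const hPn).and
      (((tend M.nash).eventually_le_const (show 0 < q / 4 by positivity)).and
      (((tend 2).eventually_le_const one_pos).and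
      ((tend 1).eventually_lt_const hρ₁))))
    obtain ⟨r, hr, hr0⟩ := (hev.and self_mem_nhdsWithin).exists
    exact ⟨r, hr0, hr.1, hr.2.1, hr.2.2.1, hr.2.2.2.1, by simpa using hr.2.2.2.2⟩
  set m := r * Real.exp (-(K * E 1 ^ 2)) with hm
  have hm0 : 0 < m := mul_pos hr0 (Real.exp_pos _)
  -- Since `0 ≤ t * E t ^ 2 ≤ E 1 ^ 2`, the decreasing barrier stays between `m` and `r`.
  set ψ : ℝ → ℝ := fun t => m * Real.exp (K * (t * E t ^ 2)) with hψ
  have hψ0 : ∀ t, 0 < ψ t := fun t => mul_pos hm0 (Real.exp_pos _)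
  have hψr : ∀ t, 1 ≤ t → ψ t ≤ r := by
    intro t ht
    have h1 : ψ t = r * Real.exp (-(K * E 1 ^ 2) + K * (t * E t ^ 2)) := by
      rw [Real.exp_add, ← mul_assoc]
    rw [h1]
    refine mul_le_of_le_one_right hr0.le (Real.exp_le_one_iff.mpr ?_)
    linarith [mul_le_mul_of_nonneg_left (hdecr t ht) hK0.le]
  have hmψ : ∀ t, 1 ≤ t → m ≤ ψ t := fun t ht =>
    le_mul_of_one_le_right hm0.le (Real.one_le_exp (by positivity))
  have hψd : ∀ t, 1 ≤ t → HasDerivWithinAt ψ (ψ t * (K * Q t)) (Ici 1) t := by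
    intro t ht
    convert! (((hQd t ht).const_mul K).exp.const_mul m) using 1
    simp only [hψ]; ring
  set f : Fin N → ℝ → ℝ := fun i t => othersAvg (V t i) i - ψ t * V t i i with hf
  have hfd : ∀ i t, 1 ≤ t → HasDerivWithinAt (f i)
      (M.adj (U t) (V t) i * othersAvg (M.adj (U t) (V t)) i -
        (ψ t * (K * Q t) * V t i i + ψ t * (M.adj (U t) (V t) i * M.adj (U t) (V t) i)))
      (Ici 1) t := fun i t ht =>
    (h.hasDerivWithinAt_othersAvg_V ht i).sub ((hψd t ht).mul (h.deriv_V t ht i i))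
  have h12 : Ici (2 : ℝ) ⊆ Ici 1 := Ici_subset_Ici.mpr (by norm_num)
  have hpos : ∀ t, 2 ≤ t → ∀ i, 0 < f i t := by
    refine forall_pos_of_no_first_zero
      (fun i t ht => (hfd i t (h12 ht)).continuousWithinAt.mono h12) (fun i => ?_) ?_
    · have h1 := hr5.trans_le (hk₁ i)
      rw [lt_div_iff₀ (hV0 2 (by norm_num) i)] at h1
      have h2 := mul_le_mul_of_nonneg_right (hψr 2 (by norm_num)) (hV0 2 (by norm_num) i).le
      simp only [hf]
      linarith
    · intro T hT hbefore hnonneg i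
      have hT1 : 1 ≤ T := by linarith
      refine pos_of_pos_before_of_hasDerivWithinAt_pos hT (fun t ht => hbefore t ht i)
        ((hfd i T hT1).mono h12) (hnonneg i) fun hzero => ?_
      have hge : ∀ j, ψ T * V T j j ≤ othersAvg (V T j) j := by
        intro j
        have := hnonneg j
        simp only [hf] at this
        linarith
      have hψT := hψ0 T
      have hψT' := hψr T hT1
      have hQT := hQ T hT1
      have hD := hadj T hT1 i
      have hDbar : 0 ≤ othersAvg (M.adj (U T) (V T)) i :=
        le_othersAvg hN fun j _ => (hadj T hT1 j).le
      have hVT : σ k₀ ^ 2 ≤ V T i i := (hk₀ i).trans (hVσ T hT1 i)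
      have hQV : K * (θ * E T ^ 2) * σ k₀ ^ 2 ≤ -(K * Q T) * V T i i := by
        refine mul_le_mul ?_ hVT hσ0.le ?_
        · linarith [mul_le_mul_of_nonneg_left hQT hK0.le]
        · have : 0 ≤ θ * E T ^ 2 := by positivity
          have := mul_nonneg hK0.le (show 0 ≤ -Q T by linarith)
          linarith
      have hQV' : (C ^ 2 + 1) * E T ^ 2 ≤ -(K * Q T) * V T i i := by
        refine le_trans (le_of_eq ?_) hQV
        rw [← hKθ]; ring
      have hQψ := mul_le_mul_of_nonneg_left hQV' hψT.le
      -- At a first contact `f i` has positive derivative: either the covariance growth beats `ψ`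
      -- times the variance growth, or the decay of `ψ` absorbs the deficit.
      rcases hM.adj_dichotomy hN (h.U_mem hM hμ hT1) (hUn T hT1) (hV0 T hT1) (hpull T hT1) (i := i)
        hq hψT ((mul_le_mul_of_nonneg_left hψT' hc.le).trans hr1)
        ((mul_le_mul_of_nonneg_left hψT' hq0.le).trans hr2)
        ((mul_le_mul_of_nonneg_left hψT' hn.le).trans hr3) (by linarith) hge
        (by simp only [hf] at hzero; linarith) with hcase | ⟨hE0, hcase⟩
      · have h1 := mul_lt_mul_of_pos_left hcase hD
        have h2 : 0 ≤ ψ T * ((C ^ 2 + 1) * E T ^ 2) := by positivity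
        linarith
      · have h1 := mul_nonneg hD.le hDbar
        have h2 : M.adj (U T) (V T) i * M.adj (U T) (V T) i ≤ C ^ 2 * E T ^ 2 := by
          have := mul_le_mul hcase hcase hD.le (hD.le.trans hcase)
          refine this.trans (le_of_eq ?_)
          simp only [hE]; ring
        have h3 := mul_le_mul_of_nonneg_left h2 hψT.le
        have h4 : 0 < ψ T * E T ^ 2 := mul_pos hψT (pow_pos hE0 2)
        linarith
  refine ⟨m, hm0, fun τ hτ i => ?_⟩
  have hτ1 : 1 ≤ τ := by linarith
  have h1 := hpos τ hτ i
  have h2 := mul_le_mul_of_nonneg_right (hmψ τ hτ1) (hV0 τ hτ1 i).le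
  simp only [hf] at h1
  linarith

/-- The running averages cannot all converge to the Nash price from below. -/
theorem Market.IsSolution.not_tendsto_nash (hM : M.Admissible) (hN : 2 ≤ N)
    (hσ : ∀ i, 0 < σ i) (hμ : μ ∈ M.priceBox N)
    (h : M.IsSolution μ (Matrix.diagonal fun i => σ i ^ 2) U V)
    (hpull : ∀ τ, 1 ≤ τ → ∀ i, 0 < M.pull (U τ) (V τ) i)
    (hadj : ∀ τ, 1 ≤ τ → ∀ i, 0 < M.adj (U τ) (V τ) i)
    (hUn : ∀ τ, 1 ≤ τ → ∀ i, U τ i ≤ M.nash) :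
    ¬ ∀ i, Tendsto (fun t => U t i) atTop (𝓝 M.nash) := by
  intro hlim
  have hb := hM.b_pos
  have hc := hM.c_pos
  have hmin := hM.Pmin_pos
  obtain ⟨m, hm0, hm⟩ := h.exists_le_othersAvg_V hM hN hσ hμ hpull hadj hUn
  let i : Fin N := ⟨0, by omega⟩
  have hgap : Tendsto (fun t => M.a + M.c * othersAvg (U t) i - 2 * M.b * U t i) atTop (𝓝 0) := by
    have h1 : Tendsto (fun t => M.a + M.c * othersAvg (U t) i - 2 * M.b * U t i) atTop
        (𝓝 (M.a + M.c * othersAvg (fun _ => M.nash) i - 2 * M.b * M.nash)) :=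
      (((tendsto_othersAvg hlim i).const_mul M.c).const_add M.a).sub
        ((hlim i).const_mul (2 * M.b))
    have h2 : M.a + M.c * M.nash - 2 * M.b * M.nash = 0 := by linarith [hM.nash_mul]
    rwa [othersAvg_const hN, h2] at h1
  have hPn : 0 < M.Pmax - M.nash := sub_pos.mpr hM.nash_lt_Pmax
  have hκ : 0 < M.c * M.Pmin * m / 2 := by positivity
  refine h.not_eventually_le_adj hM hμ i
    (δ := min (M.c * M.Pmin * m / 2 / (2 * M.b)) (M.Pmax - M.nash))
    (lt_min (by positivity) hPn) ?_
  -- The best-response gap tends to `0`, so the covariance term, at least `c * Pmin * m`, eventually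
  -- dominates and keeps the adjustment away from zero.
  filter_upwards [hgap.eventually_const_lt (neg_lt_zero.mpr hκ), eventually_ge_atTop 2]
    with t ht ht2
  have ht1 : 1 ≤ t := by linarith
  have hU := h.U_mem hM hμ ht1
  have hV0 : 0 < V t i i := (pow_pos (hσ i) 2).trans_le (by simpa using h.le_V_diag ht1 i)
  refine le_trans (min_le_min ?_ ?_) (hM.min_le_adj hU hV0 (hpull t ht1 i) hm0.le (hm t ht2 i))
  · gcongr
    have : M.c * M.Pmin * m ≤ M.c * U t i * m :=
      mul_le_mul_of_nonneg_right (mul_le_mul_of_nonneg_left (hU i).1 hc.le) hm0.le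
    linarith
  · linarith [hUn t ht1 i]

/-- Started in the lower best-response cone, the posted prices eventually exceed the Nash price. -/
theorem Market.IsSolution.nash_lt_price_of_lowerCone (hM : M.Admissible) (hN : 2 ≤ N)
    (hσ : ∀ i, 0 < σ i) (h : M.IsSolution μ (Matrix.diagonal fun i => σ i ^ 2) U V)
    (hμ : μ ∈ M.lowerCone N) :
    ∃ τ₀ : ℝ, 1 ≤ τ₀ ∧ ∀ τ : ℝ, τ₀ < τ → ∀ i, M.nash < M.price (U τ) (V τ) i := by
  have hpull : ∀ τ, 1 ≤ τ → ∀ i, 0 < M.pull (U τ) (V τ) i := fun τ hτ i =>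
    (h.pull_pos_of_lowerCone hM hN hσ hμ hτ i).1
  have hadj : ∀ τ, 1 ≤ τ → ∀ i, 0 < M.adj (U τ) (V τ) i := fun τ hτ i =>
    (h.pull_pos_of_lowerCone hM hN hσ hμ hτ i).2
  by_cases hex : ∃ τ, 1 ≤ τ ∧ ∀ i, M.nash < U τ i
  · obtain ⟨τ₀, hτ₀, hlt⟩ := hex
    refine ⟨τ₀, hτ₀, fun τ hτ i => ?_⟩
    have h1 : 1 ≤ τ := hτ₀.trans hτ.le
    have h2 := h.monotoneOn_U hadj i (mem_Ici.mpr hτ₀) (mem_Ici.mpr h1) hτ.le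
    exact (hlt i).trans (lt_of_le_of_lt h2 (sub_pos.mp (hadj τ h1 i)))
  · have hlim := h.tendsto_nash hM hN hσ hμ.1 hpull hadj hex
    exact absurd (fun i => (hlim i).1)
      (h.not_tendsto_nash hM hN hσ hμ.1 hpull hadj fun τ hτ i => (hlim i).2 τ hτ)

end NashLimit

end PriceMoments

theorem mainTheorem1 (M : PriceMoments.Market) (hM : M.Admissible) (N : ℕ) (hN : 2 ≤ N)
    (μ : Fin N → ℝ) (hμ : μ ∈ M.priceBox N) (σ : Fin N → ℝ) (hσ : ∀ i, 0 < σ i) :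
    -- the price-moments ODE has a solution, unique on `[1, ∞)`, ...
    ∃ (U : ℝ → Fin N → ℝ) (V : ℝ → Matrix (Fin N) (Fin N) ℝ),
      M.IsSolution μ (Matrix.diagonal fun i => σ i ^ 2) U V ∧
      (∀ U' V', M.IsSolution μ (Matrix.diagonal fun i => σ i ^ 2) U' V' →
        ∀ τ : ℝ, 1 ≤ τ → U' τ = U τ ∧ V' τ = V τ) ∧
      -- ... and its posted prices satisfy (a) and (b)
      (μ ∈ M.upperCone N → ∀ τ : ℝ, 1 ≤ τ → ∀ i, M.nash < M.price (U τ) (V τ) i) ∧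
      (μ ∈ M.lowerCone N → ∃ τ₀ : ℝ, 1 ≤ τ₀ ∧
        ∀ τ : ℝ, τ₀ < τ → ∀ i, M.nash < M.price (U τ) (V τ) i) := by
  obtain ⟨U, V, h⟩ := hM.exists_isSolution hN hμ hσ
  exact ⟨U, V, h, fun U' V' h' τ hτ => h.unique hM hN hμ hσ h' hτ,
    fun hup τ hτ i => h.nash_lt_price_of_upperCone hM hN hσ hup hτ i,
    fun hlow => h.nash_lt_price_of_lowerCone hM hN hσ hlow⟩
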